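/- **Setting.** $\mathsf{CZF}^-$ is the theory, in intuitionistic first-order logic with equality in the language $\{\in\}$, with the axioms Extensionality, Pairing, Union, Empty Set, Infinity, and the schemes of $\Delta_0$-Separation, Replacement, $\in$-Induction (for all formulas), and Strong Collection: if $\forall x\in a\,\exists y\,\phi(x,y)$, then there is a set $b$ with $\forall x\in a\,\exists y\in b\,\phi(x,y)$ and $\forall y\in b\,\exists x\in a\,\phi(x,y)$. A class is $\{u\mid\phi(u,\vec p)\}$ for a formula $\phi$ with set parameters $\vec p$. For a class $A$ and a formula $\psi$, $\psi^A$ is the relativization of $\psi$ to $A$ (all quantifiers restricted to $A$). A transitive model of $\mathsf{CZF}^-$ without Infinity is a transitive class $A$ such that $\sigma^A$ holds for each axiom $\sigma$ (with universally closed parameters) of $\mathsf{CZF}^-$ other than Infinity. Write $0=\varnothing$, $1=\{0\}$. A set $p\subseteq 1$ is stable if $p=\{0\mid\neg\neg(0\in p)\}$. The Heyting universe $V^\Omega$ over the double negation formal topology $\Omega$ is the class defined inductively by: $a\in V^\Omega$ iff $a$ is a function with $\operatorname{dom}a\subseteq V^\Omega$ all of whose values are stable subsets of $1$. Explicitly,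 $u\in V^\Omega$ iff there are sets $g,b$ with $\langle b,u\rangle\in g$ such that, whenever $\langle c,a\rangle\in g$, $a$ is a function whose values are stable subsets of $1$ and for each $x\in\operatorname{dom}a$ there is $d\in c$ with $\langle d,x\rangle\in g$. For a class $A$, $A^\Omega:=(V^\Omega)^A$ is the class of all $u\in A$ that satisfy the relativization to $A$ of this definition. **Lemma.** For every class $A$, the following is provable (intuitionistically) in $\mathsf{CZF}^-$. If $A$ is a transitive model of $\mathsf{CZF}^-$ without Infinity, then $$A^\Omega=V^\Omega\cap A .$$ Moreover, if in addition $A$ is a set, then $A^\Omega$ is a set. Here, "provable" means that the conclusion is derivable from the axioms of $\mathsf{CZF}^-$, the transitivity of $A$, and the sentences $\sigma^A$ (for the second part, also from the assumption that $A$ is a set), the parameters of $A$ being held fixed. -/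

import Mathlib

namespace CZF

/-! ### Intuitionistic first-order logic with equality in the language of set theory

The only non-logical symbol is the binary relation symbol for membership, so the only terms are
variables. Variables are de Bruijn indices: under a quantifier, index `0` is the variable bound by
the innermost quantifier and index `n + 1` is what index `n` was outside. All connectives and both
quantifiers are primitive, since they are not interdefinable intuitionistically. -/

/-- Formulas of set theory. -/
inductive Fml : Type
  | bot : Fml
  | mem : ℕ → ℕ → Fml
  | eq : ℕ → ℕ → Fml
  | conj : Fml → Fml → Fml
  | disj : Fml → Fml → Fml
  | imp : Fml → Fml → Fml
  | all : Fml → Fml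
  | ex : Fml → Fml

infixr:67 " ⋏ " => Fml.conj
infixr:66 " ⋎ " => Fml.disj
infixr:65 " ⟹ " => Fml.imp

namespace Fml

/-- Negation. -/
def neg (φ : Fml) : Fml := φ ⟹ bot

/-- Biconditional. -/
def iff (φ ψ : Fml) : Fml := (φ ⟹ ψ) ⋏ (ψ ⟹ φ)

/-- The action of a renaming of variables under one binder. -/
def up (f : ℕ → ℕ) : ℕ → ℕ
  | 0 => 0
  | n + 1 => f n + 1

/-- Simultaneous (capture-avoiding) substitution of the variable `f n` for each free
variable `n`. -/
def rename : (ℕ → ℕ) → Fml → Fml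
  | _, bot => bot
  | f, mem x y => mem (f x) (f y)
  | f, eq x y => eq (f x) (f y)
  | f, conj φ ψ => conj (rename f φ) (rename f ψ)
  | f, disj φ ψ => disj (rename f φ) (rename f ψ)
  | f, imp φ ψ => imp (rename f φ) (rename f ψ)
  | f, all φ => all (rename (up f) φ)
  | f, ex φ => ex (rename (up f) φ)

/-- Weakening: the same formula, read under one more binder that it does not mention. -/
def shift (φ : Fml) : Fml := φ.rename Nat.succ

/-- `φ.inst t` is the body `φ` of a quantifier with its bound variable replaced by `t`. -/
def inst (φ : Fml) (t : ℕ) : Fml :=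
  φ.rename (fun n => match n with
    | 0 => t
    | k + 1 => k)

/-- `φ.sub1 x d`, for a formula `φ(u, p⃗)` whose variable `0` is `u` and whose variable `k + 1` is
the parameter `p_k`: the formula `φ(x, p⃗)`, written under `d` binders. -/
def sub1 (φ : Fml) (x d : ℕ) : Fml :=
  φ.rename (fun n => match n with
    | 0 => x
    | k + 1 => k + d)

/-- `φ.sub2 x y d`, for a formula `φ(u, v, p⃗)` whose variables `0`, `1`, `k + 2` are
`u`, `v`, `p_k`: the formula `φ(x, y, p⃗)`, written under `d` binders. -/
def sub2 (φ : Fml) (x y d : ℕ) : Fml :=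
  φ.rename (fun n => match n with
    | 0 => x
    | 1 => y
    | k + 2 => k + d)

/-- All free variables of the formula are `< n`. -/
def FreeLt : ℕ → Fml → Prop
  | _, bot => True
  | n, mem x y => x < n ∧ y < n
  | n, eq x y => x < n ∧ y < n
  | n, conj φ ψ => FreeLt n φ ∧ FreeLt n ψ
  | n, disj φ ψ => FreeLt n φ ∧ FreeLt n ψ
  | n, imp φ ψ => FreeLt n φ ∧ FreeLt n ψ
  | n, all φ => FreeLt (n + 1) φ
  | n, ex φ => FreeLt (n + 1) φ

/-- A sentence is a formula without free variables. -/
def IsSentence (φ : Fml) : Prop := FreeLt 0 φ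

/-- Bounded universal quantification `∀ x ∈ t, φ`, where `t` is a variable outside the binder. -/
def ball (t : ℕ) (φ : Fml) : Fml := all (mem 0 (t + 1) ⟹ φ)

/-- Bounded existential quantification `∃ x ∈ t, φ`, where `t` is a variable outside the
binder. -/
def bex (t : ℕ) (φ : Fml) : Fml := ex (mem 0 (t + 1) ⋏ φ)

/-- Bounded (`Δ₀`) formulas. -/
inductive IsDelta0 : Fml → Prop
  | bot : IsDelta0 bot
  | mem (x y : ℕ) : IsDelta0 (mem x y)
  | eq (x y : ℕ) : IsDelta0 (eq x y)
  | conj {φ ψ : Fml} : IsDelta0 φ → IsDelta0 ψ → IsDelta0 (φ ⋏ ψ)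
  | disj {φ ψ : Fml} : IsDelta0 φ → IsDelta0 ψ → IsDelta0 (φ ⋎ ψ)
  | imp {φ ψ : Fml} : IsDelta0 φ → IsDelta0 ψ → IsDelta0 (φ ⟹ ψ)
  | ball (t : ℕ) {φ : Fml} : IsDelta0 φ → IsDelta0 (ball t φ)
  | bex (t : ℕ) {φ : Fml} : IsDelta0 φ → IsDelta0 (bex t φ)

end Fml

open Fml

/-- Derivability in intuitionistic first-order logic with equality (natural deduction):
`Prf Γ φ` says that `φ` is derivable from the assumptions `Γ`. Free variables of the assumptions
are treated as fixed parameters; the eigenvariable conditions are expressed by `shift`. -/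
inductive Prf : Set Fml → Fml → Prop
  | hyp {Γ : Set Fml} {φ : Fml} : φ ∈ Γ → Prf Γ φ
  | botE {Γ : Set Fml} {φ : Fml} : Prf Γ bot → Prf Γ φ
  | conjI {Γ : Set Fml} {φ ψ : Fml} : Prf Γ φ → Prf Γ ψ → Prf Γ (φ ⋏ ψ)
  | conjE₁ {Γ : Set Fml} {φ ψ : Fml} : Prf Γ (φ ⋏ ψ) → Prf Γ φ
  | conjE₂ {Γ : Set Fml} {φ ψ : Fml} : Prf Γ (φ ⋏ ψ) → Prf Γ ψ
  | disjI₁ {Γ : Set Fml} {φ ψ : Fml} : Prf Γ φ → Prf Γ (φ ⋎ ψ)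
  | disjI₂ {Γ : Set Fml} {φ ψ : Fml} : Prf Γ ψ → Prf Γ (φ ⋎ ψ)
  | disjE {Γ : Set Fml} {φ ψ χ : Fml} :
      Prf Γ (φ ⋎ ψ) → Prf (insert φ Γ) χ → Prf (insert ψ Γ) χ → Prf Γ χ
  | impI {Γ : Set Fml} {φ ψ : Fml} : Prf (insert φ Γ) ψ → Prf Γ (φ ⟹ ψ)
  | impE {Γ : Set Fml} {φ ψ : Fml} : Prf Γ (φ ⟹ ψ) → Prf Γ φ → Prf Γ ψ
  | allI {Γ : Set Fml} {φ : Fml} : Prf (shift '' Γ) φ → Prf Γ (all φ)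
  | allE {Γ : Set Fml} {φ : Fml} (t : ℕ) : Prf Γ (all φ) → Prf Γ (φ.inst t)
  | exI {Γ : Set Fml} {φ : Fml} (t : ℕ) : Prf Γ (φ.inst t) → Prf Γ (ex φ)
  | exE {Γ : Set Fml} {φ ψ : Fml} :
      Prf Γ (ex φ) → Prf (insert φ (shift '' Γ)) (shift ψ) → Prf Γ ψ
  | eqRefl {Γ : Set Fml} (t : ℕ) : Prf Γ (eq t t)
  | eqSubst {Γ : Set Fml} {φ : Fml} {s t : ℕ} :
      Prf Γ (eq s t) → Prf Γ (φ.inst s) → Prf Γ (φ.inst t)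

/-! ### Basic set-theoretic notions as formulas in given variables -/

/-- `x = ∅`. -/
def isEmpty (x : ℕ) : Fml := all (neg (mem 0 (x + 1)))

/-- `z = {x, y}`. -/
def isPair (z x y : ℕ) : Fml := all (iff (mem 0 (z + 1)) (eq 0 (x + 1) ⋎ eq 0 (y + 1)))

/-- `p = ⟨x, y⟩ = {{x}, {x, y}}`. -/
def isOPair (p x y : ℕ) : Fml :=
  all (iff (mem 0 (p + 1)) (isPair 0 (x + 1) (x + 1) ⋎ isPair 0 (x + 1) (y + 1)))

/-- `⟨x, y⟩ ∈ r`. -/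
def opairMem (x y r : ℕ) : Fml := bex r (isOPair 0 (x + 1) (y + 1))

/-- `y = x ∪ {x}`. -/
def isSucc (y x : ℕ) : Fml := all (iff (mem 0 (y + 1)) (mem 0 (x + 1) ⋎ eq 0 (x + 1)))

/-- `a` is a function, i.e. a single-valued set of ordered pairs. -/
def isFunction (a : ℕ) : Fml :=
  ball a (ex (ex (isOPair 2 1 0))) ⋏
  all (all (all (opairMem 2 1 (a + 3) ⋏ opairMem 2 0 (a + 3) ⟹ eq 1 0)))

/-! ### The theory `CZF⁻` -/

/-- `∀ a b, (∀ x, x ∈ a ↔ x ∈ b) → a = b`. -/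
def extensionality : Fml := all (all (all (iff (mem 0 2) (mem 0 1)) ⟹ eq 1 0))

/-- `∀ a b, ∃ c, c = {a, b}`. -/
def pairing : Fml := all (all (ex (isPair 0 2 1)))

/-- `∀ a, ∃ b, ∀ x, x ∈ b ↔ ∃ y ∈ a, x ∈ y`. -/
def union : Fml := all (ex (all (iff (mem 0 1) (bex 2 (mem 1 0)))))

/-- `∃ a, a = ∅`. -/
def emptySet : Fml := ex (isEmpty 0)

/-- `∃ a, (∃ x ∈ a, x = ∅) ∧ ∀ x ∈ a, ∃ y ∈ a, y = x ∪ {x}`. -/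
def infinity : Fml := ex (bex 0 (isEmpty 0) ⋏ ball 0 (bex 1 (isSucc 0 1)))

/-- Separation for `φ(x)`: `∀ a, ∃ b, ∀ x, x ∈ b ↔ x ∈ a ∧ φ(x)`. -/
def separation (φ : Fml) : Fml :=
  all (ex (all (iff (mem 0 1) (mem 0 2 ⋏ φ.sub1 0 3))))

/-- Replacement for `φ(x, y)`:
`∀ a, (∀ x ∈ a, ∃! y, φ(x, y)) → ∃ b, ∀ y, y ∈ b ↔ ∃ x ∈ a, φ(x, y)`,
where `∃! y, φ(x, y)` is `∃ y, φ(x, y) ∧ ∀ z, φ(x, z) → z = y`. -/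
def replacement (φ : Fml) : Fml :=
  all (ball 0 (ex (φ.sub2 1 0 3 ⋏ all (φ.sub2 2 0 4 ⟹ eq 0 1))) ⟹
    ex (all (iff (mem 0 1) (bex 2 (φ.sub2 0 1 4)))))

/-- `∈`-induction for `φ(x)`: `(∀ x, (∀ y ∈ x, φ(y)) → φ(x)) → ∀ x, φ(x)`. -/
def induction (φ : Fml) : Fml :=
  all (ball 0 (φ.sub1 0 2) ⟹ φ.sub1 0 1) ⟹ all (φ.sub1 0 1)

/-- Strong Collection for `φ(x, y)`:
`∀ a, (∀ x ∈ a, ∃ y, φ(x, y)) →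
  ∃ b, (∀ x ∈ a, ∃ y ∈ b, φ(x, y)) ∧ (∀ y ∈ b, ∃ x ∈ a, φ(x, y))`. -/
def strongCollection (φ : Fml) : Fml :=
  all (ball 0 (ex (φ.sub2 1 0 3)) ⟹
    ex (ball 1 (bex 1 (φ.sub2 1 0 4)) ⋏ ball 0 (bex 2 (φ.sub2 0 1 4))))

/-- The universal closures of a set of formulas. -/
def closures (S : Set Fml) : Set Fml :=
  {σ | IsSentence σ ∧ ∃ φ ∈ S, ∃ n : ℕ, σ = all^[n] φ}

/-- `CZF⁻` without Infinity, as a set of sentences. -/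
def CZFMinusNoInf : Set Fml :=
  {extensionality, pairing, union, emptySet} ∪
  closures {ψ | ∃ φ, IsDelta0 φ ∧ ψ = separation φ} ∪
  closures {ψ | ∃ φ, ψ = replacement φ} ∪
  closures {ψ | ∃ φ, ψ = induction φ} ∪
  closures {ψ | ∃ φ, ψ = strongCollection φ}

/-- `CZF⁻`, as a set of sentences. -/
def CZFMinus : Set Fml := insert infinity CZFMinusNoInf

/-! ### Classes

A class `{u | φ(u, p⃗)}` is given by its formula `φ`: variable `0` is `u`, and variable `k + 1` is
the parameter `p_k`. Two classes may share parameters. -/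

/-- The classes `C` and `D` have the same elements. -/
def classEq (C D : Fml) : Fml := all (iff C D)

/-- The class `C` is a set: `∃ a, ∀ x, x ∈ a ↔ x ∈ C`. -/
def isSet (C : Fml) : Fml := ex (all (iff (mem 0 1) (C.sub1 0 2)))

/-- The class `A` is transitive: `∀ x, x ∈ A → ∀ y ∈ x, y ∈ A`. -/
def transitive (A : Fml) : Fml := all (A.sub1 0 1 ⟹ ball 0 (A.sub1 0 2))

/-- `rel A d φ` is the relativization `φ^A`: every quantifier of `φ` is restricted to the class
`A`. The number `d` counts the binders under which `φ` stands, i.e. parameter `k` of `A` is the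
variable `k + d` at this place. -/
def rel (A : Fml) : ℕ → Fml → Fml
  | _, bot => bot
  | _, mem x y => mem x y
  | _, eq x y => eq x y
  | d, conj φ ψ => rel A d φ ⋏ rel A d ψ
  | d, disj φ ψ => rel A d φ ⋎ rel A d ψ
  | d, imp φ ψ => rel A d φ ⟹ rel A d ψ
  | d, all φ => all (A.sub1 0 (d + 1) ⟹ rel A (d + 1) φ)
  | d, ex φ => ex (A.sub1 0 (d + 1) ⋏ rel A (d + 1) φ)

/-- The class `C`, defined in `A`: `C^A = {u ∈ A | (u ∈ C)^A}`. -/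
def relClass (A C : Fml) : Fml := A ⋏ rel A 1 C

/-- The assumptions "`CZF⁻` holds (in the universe), and the class `A` is a transitive model of
`CZF⁻` without Infinity". -/
def transitiveModel (A : Fml) : Set Fml :=
  CZFMinus ∪ {transitive A} ∪ rel A 0 '' CZFMinusNoInf

/-! ### The Heyting universe `V^Ω` over the double negation formal topology -/

/-- `p` is a stable subset of `1 = {∅}`, i.e. an element of `Low(Ω)_j`:
`p = {0 | ¬¬ (0 ∈ p)}`. -/
def isStable (p : ℕ) : Fml :=
  all (iff (mem 0 (p + 1)) (isEmpty 0 ⋏ neg (neg (mem 0 (p + 1)))))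

/-- Let `Γ(C)` be the class of all functions `a` with `dom a ⊆ C` whose values are stable subsets
of `1`. This formula says that `g` is a good set of pairs for `Γ`: whenever `⟨b, a⟩ ∈ g`, then
`a ∈ Γ({x | ∃ c ∈ b, ⟨c, x⟩ ∈ g})`. -/
def isGood (g : ℕ) : Fml :=
  all (all (opairMem 1 0 (g + 2) ⟹
    isFunction 0 ⋏
    all (all (opairMem 1 0 2 ⟹ bex 3 (opairMem 0 2 (g + 5)) ⋏ isStable 0))))

/-- The class `V^Ω`. It is inductively defined by: `a ∈ V^Ω` iff `a` is a function from some
`dom a ⊆ V^Ω` to the stable subsets of `1`, i.e. it is the least class `C` with `Γ(C) ⊆ C`. As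
usual in `CZF⁻`, the least class is the union `⋃_b J^b` of the iteration class
`J^b = Γ(⋃_{c ∈ b} J^c)`, and `J` is the union of all good sets:
`u ∈ V^Ω` iff there are a good set `g` and a stage `b` with `⟨b, u⟩ ∈ g`. -/
def VOmega : Fml := ex (ex (isGood 1 ⋏ opairMem 0 2 1))

/-- `A^Ω = (V^Ω)^A`. -/
def relOmega (A : Fml) : Fml := relClass A VOmega

end CZF

namespace CZF

open Fml

/-! ### Renaming -/

namespace Fml

/-! Derivability is replaced by validity in Kripke models. A Henkin construction, carried out
classically in the metatheory, gives completeness (`Prf.of_force`): a formula is derivable from `Γ`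
as soon as it is forced in every Kripke model of `Γ` in which the parameters are interpreted by a
compatible family of individuals. It then suffices to run the set-theoretic argument inside such a
model `K`, where the class `A` becomes a submodel (`force_rel`).

Being a pair, a function, a stable subset of 1 or a good set is absolute for a transitive class that
models the basic axioms (`good_val`). So a good set and a stage found in `A` also witness membership
in the full `V^Ω`, and `A^Ω ⊆ V^Ω ∩ A`.

The converse is not immediate, because the good set witnessing `u ∈ V^Ω` may lie outside `A`. It is
proved by ∈-induction on `u` in the universe. Every `x ∈ dom u` lies in `A` by transitivity and in
`V^Ω` by goodness, hence in `A^Ω` by induction. Strong Collection inside `A` gathers good sets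
covering `dom u` into one set `B ∈ A`, and ⋃B together with one pair ⟨c, u⟩ is a good set in `A`
(`Basic.inVOmega_of_cover`). Infinity is never needed, since any set can serve as a stage.

If `A` is a set, relativization to it turns every quantifier into a bounded one, so Δ₀-Separation
yields `A^Ω`. -/

theorem up_comp (g f : ℕ → ℕ) : up (g ∘ f) = up g ∘ up f := by
  funext n
  cases n <;> rfl

theorem rename_rename (g f : ℕ → ℕ) (φ : Fml) : (φ.rename f).rename g = φ.rename (g ∘ f) := by
  induction φ generalizing f g <;> simp_all [rename, up_comp]

theorem up_id : up id = id := by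
  funext n
  cases n <;> rfl

theorem rename_id (φ : Fml) : φ.rename id = φ := by
  induction φ <;> simp_all [rename, up_id]

theorem FreeLt.rename_congr {f g : ℕ → ℕ} {φ : Fml} {n : ℕ} (h : FreeLt n φ)
    (hfg : ∀ i < n, f i = g i) : φ.rename f = φ.rename g := by
  induction φ generalizing f g n with
  | bot => rfl
  | mem x y => simp [rename, hfg _ h.1, hfg _ h.2]
  | eq x y => simp [rename, hfg _ h.1, hfg _ h.2]
  | conj _ _ h₁ h₂ => simp [rename, h₁ h.1 hfg, h₂ h.2 hfg]
  | disj _ _ h₁ h₂ => simp [rename, h₁ h.1 hfg, h₂ h.2 hfg]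
  | imp _ _ h₁ h₂ => simp [rename, h₁ h.1 hfg, h₂ h.2 hfg]
  | all _ ih =>
    simp only [rename]
    rw [ih h]
    rintro (_ | i) hi
    · rfl
    · simp [up, hfg i (by omega)]
  | ex _ ih =>
    simp only [rename]
    rw [ih h]
    rintro (_ | i) hi
    · rfl
    · simp [up, hfg i (by omega)]

theorem FreeLt.mono {φ : Fml} {m n : ℕ} (h : FreeLt m φ) (hmn : m ≤ n) : FreeLt n φ := by
  induction φ generalizing m n with
  | bot => trivial
  | mem x y => exact ⟨h.1.trans_le hmn, h.2.trans_le hmn⟩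
  | eq x y => exact ⟨h.1.trans_le hmn, h.2.trans_le hmn⟩
  | conj _ _ h₁ h₂ => exact ⟨h₁ h.1 hmn, h₂ h.2 hmn⟩
  | disj _ _ h₁ h₂ => exact ⟨h₁ h.1 hmn, h₂ h.2 hmn⟩
  | imp _ _ h₁ h₂ => exact ⟨h₁ h.1 hmn, h₂ h.2 hmn⟩
  | all _ ih => exact ih (m := m + 1) (n := n + 1) h (by omega)
  | ex _ ih => exact ih (m := m + 1) (n := n + 1) h (by omega)

theorem exists_freeLt (φ : Fml) : ∃ n, FreeLt n φ := by
  induction φ with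
  | bot => exact ⟨0, trivial⟩
  | mem x y => exact ⟨x + y + 1, by omega, by omega⟩
  | eq x y => exact ⟨x + y + 1, by omega, by omega⟩
  | conj _ _ h₁ h₂ =>
    obtain ⟨⟨m, hm⟩, n, hn⟩ := And.intro h₁ h₂
    exact ⟨m + n, hm.mono (by omega), hn.mono (by omega)⟩
  | disj _ _ h₁ h₂ =>
    obtain ⟨⟨m, hm⟩, n, hn⟩ := And.intro h₁ h₂
    exact ⟨m + n, hm.mono (by omega), hn.mono (by omega)⟩
  | imp _ _ h₁ h₂ =>
    obtain ⟨⟨m, hm⟩, n, hn⟩ := And.intro h₁ h₂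
    exact ⟨m + n, hm.mono (by omega), hn.mono (by omega)⟩
  | all _ ih =>
    obtain ⟨n, hn⟩ := ih
    exact ⟨n, hn.mono (by omega)⟩
  | ex _ ih =>
    obtain ⟨n, hn⟩ := ih
    exact ⟨n, hn.mono (by omega)⟩

theorem rename_inst (f : ℕ → ℕ) (φ : Fml) (t : ℕ) :
    (φ.inst t).rename f = (φ.rename (up f)).inst (f t) := by
  simp only [inst, rename_rename]
  congr 1
  funext n
  cases n <;> rfl

theorem rename_shift (f : ℕ → ℕ) (φ : Fml) :
    φ.shift.rename (up f) = (φ.rename f).shift := by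
  simp only [shift, rename_rename]
  rfl

theorem image_shift_rename (f : ℕ → ℕ) (Γ : Set Fml) :
    rename (up f) '' (shift '' Γ) = shift '' (rename f '' Γ) := by
  simp only [Set.image_image, rename_shift]

end Fml

/-! ### Structural properties of derivations -/

namespace Prf

theorem weaken {Γ Δ : Set Fml} {φ : Fml} (h : Prf Γ φ) (hs : Γ ⊆ Δ) : Prf Δ φ := by
  induction h generalizing Δ with
  | hyp h => exact hyp (hs h)
  | botE _ ih => exact botE (ih hs)
  | conjI _ _ h₁ h₂ => exact conjI (h₁ hs) (h₂ hs)
  | conjE₁ _ ih => exact conjE₁ (ih hs)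
  | conjE₂ _ ih => exact conjE₂ (ih hs)
  | disjI₁ _ ih => exact disjI₁ (ih hs)
  | disjI₂ _ ih => exact disjI₂ (ih hs)
  | disjE _ _ _ h h₁ h₂ =>
    exact disjE (h hs) (h₁ (Set.insert_subset_insert hs)) (h₂ (Set.insert_subset_insert hs))
  | impI _ ih => exact impI (ih (Set.insert_subset_insert hs))
  | impE _ _ h₁ h₂ => exact impE (h₁ hs) (h₂ hs)
  | allI _ ih => exact allI (ih (Set.image_mono hs))
  | allE t _ ih => exact allE t (ih hs)
  | exI t _ ih => exact exI t (ih hs)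
  | exE _ _ h₁ h₂ => exact exE (h₁ hs) (h₂ (Set.insert_subset_insert (Set.image_mono hs)))
  | eqRefl t => exact eqRefl t
  | eqSubst _ _ h₁ h₂ => exact eqSubst (h₁ hs) (h₂ hs)

theorem cut {Γ : Set Fml} {φ ψ : Fml} (h₁ : Prf Γ φ) (h₂ : Prf (insert φ Γ) ψ) : Prf Γ ψ :=
  impE (impI h₂) h₁

theorem rename {Γ : Set Fml} {φ : Fml} (h : Prf Γ φ) (f : ℕ → ℕ) :
    Prf (Fml.rename f '' Γ) (φ.rename f) := by
  induction h generalizing f with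
  | hyp h => exact hyp ⟨_, h, rfl⟩
  | botE _ ih => exact botE (ih f)
  | conjI _ _ h₁ h₂ => exact conjI (h₁ f) (h₂ f)
  | conjE₁ _ ih => exact conjE₁ (ih f)
  | conjE₂ _ ih => exact conjE₂ (ih f)
  | disjI₁ _ ih => exact disjI₁ (ih f)
  | disjI₂ _ ih => exact disjI₂ (ih f)
  | disjE _ _ _ h h₁ h₂ =>
    simp only [Set.image_insert_eq] at h₁ h₂
    exact disjE (h f) (h₁ f) (h₂ f)
  | impI _ ih =>
    simp only [Set.image_insert_eq] at ih
    exact impI (ih f)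
  | impE _ _ h₁ h₂ => exact impE (h₁ f) (h₂ f)
  | allI _ ih => exact allI (image_shift_rename f _ ▸ ih (up f))
  | allE t _ ih => exact rename_inst f _ t ▸ allE (f t) (ih f)
  | exI t _ ih => exact exI (f t) (rename_inst f _ t ▸ ih f)
  | exE _ _ h₁ h₂ =>
    have h := h₂ (up f)
    rw [Set.image_insert_eq, image_shift_rename, rename_shift] at h
    exact exE (h₁ f) h
  | eqRefl t => exact eqRefl (f t)
  | @eqSubst _ φ s t _ _ h₁ h₂ =>
    rw [rename_inst]
    exact eqSubst (h₁ f) (rename_inst f φ s ▸ h₂ f)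

/-- Renaming back along a left inverse shows that injective renamings are conservative; this lets
variables be set aside as fresh witnesses. -/
theorem of_rename {Γ : Set Fml} {φ : Fml} {f g : ℕ → ℕ} (hgf : g ∘ f = id)
    (h : Prf (Fml.rename f '' Γ) (φ.rename f)) : Prf Γ φ := by
  have := h.rename g
  simpa only [Set.image_image, rename_rename, hgf, rename_id, Set.image_id'] using this

/-- Derivations use only a stage of an increasing union of assumptions. -/
theorem exists_stage {Γ : Set Fml} {φ : Fml} (h : Prf Γ φ) (S : ℕ → Set Fml) (hS : Monotone S)
    (hΓ : Γ ⊆ ⋃ n, S n) : ∃ n, Prf (S n) φ := by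
  have ins (φ : Fml) {Γ : Set Fml} {S : ℕ → Set Fml} (hS : Monotone S) (hΓ : Γ ⊆ ⋃ n, S n) :
      Monotone (fun n => insert φ (S n)) ∧ insert φ Γ ⊆ ⋃ n, insert φ (S n) := by
    refine ⟨fun m n h => Set.insert_subset_insert (hS h), Set.insert_subset ?_ fun ψ hψ => ?_⟩
    · exact Set.mem_iUnion.2 ⟨0, Set.mem_insert _ _⟩
    · obtain ⟨n, hn⟩ := Set.mem_iUnion.1 (hΓ hψ)
      exact Set.mem_iUnion.2 ⟨n, Set.mem_insert_of_mem _ hn⟩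
  have shf {Γ : Set Fml} {S : ℕ → Set Fml} (hS : Monotone S) (hΓ : Γ ⊆ ⋃ n, S n) :
      Monotone (fun n => shift '' S n) ∧ shift '' Γ ⊆ ⋃ n, shift '' S n :=
    ⟨fun m n h => Set.image_mono (hS h), Set.image_iUnion ▸ Set.image_mono hΓ⟩
  induction h generalizing S with
  | hyp h =>
    obtain ⟨n, hn⟩ := Set.mem_iUnion.1 (hΓ h)
    exact ⟨n, hyp hn⟩
  | botE _ ih => exact (ih S hS hΓ).imp fun _ => botE
  | conjI _ _ h₁ h₂ =>
    obtain ⟨⟨m, hm⟩, n, hn⟩ := And.intro (h₁ S hS hΓ) (h₂ S hS hΓ)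
    exact ⟨max m n, conjI (hm.weaken (hS (by omega))) (hn.weaken (hS (by omega)))⟩
  | conjE₁ _ ih => exact (ih S hS hΓ).imp fun _ => conjE₁
  | conjE₂ _ ih => exact (ih S hS hΓ).imp fun _ => conjE₂
  | disjI₁ _ ih => exact (ih S hS hΓ).imp fun _ => disjI₁
  | disjI₂ _ ih => exact (ih S hS hΓ).imp fun _ => disjI₂
  | disjE _ _ _ h h₁ h₂ =>
    obtain ⟨k, hk⟩ := h S hS hΓ
    obtain ⟨m, hm⟩ := h₁ _ (ins _ hS hΓ).1 (ins _ hS hΓ).2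
    obtain ⟨n, hn⟩ := h₂ _ (ins _ hS hΓ).1 (ins _ hS hΓ).2
    exact ⟨max k (max m n), disjE (hk.weaken (hS (by omega)))
      (hm.weaken ((ins _ hS hΓ).1 (by omega))) (hn.weaken ((ins _ hS hΓ).1 (by omega)))⟩
  | impI _ ih => exact (ih _ (ins _ hS hΓ).1 (ins _ hS hΓ).2).imp fun _ => impI
  | impE _ _ h₁ h₂ =>
    obtain ⟨⟨m, hm⟩, n, hn⟩ := And.intro (h₁ S hS hΓ) (h₂ S hS hΓ)
    exact ⟨max m n, impE (hm.weaken (hS (by omega))) (hn.weaken (hS (by omega)))⟩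
  | allI _ ih => exact (ih _ (shf hS hΓ).1 (shf hS hΓ).2).imp fun _ => allI
  | allE t _ ih => exact (ih S hS hΓ).imp fun _ => allE t
  | exI t _ ih => exact (ih S hS hΓ).imp fun _ => exI t
  | @exE Γ φ ψ _ _ h₁ h₂ =>
    have hs := shf hS hΓ
    obtain ⟨m, hm⟩ := h₁ S hS hΓ
    obtain ⟨n, hn⟩ := h₂ _ (ins φ hs.1 hs.2).1 (ins φ hs.1 hs.2).2
    exact ⟨max m n, exE (hm.weaken (hS (by omega)))
      (hn.weaken ((ins φ hs.1 hs.2).1 (by omega)))⟩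
  | eqRefl t => exact ⟨0, eqRefl t⟩
  | eqSubst _ _ h₁ h₂ =>
    obtain ⟨⟨m, hm⟩, n, hn⟩ := And.intro (h₁ S hS hΓ) (h₂ S hS hΓ)
    exact ⟨max m n, eqSubst (hm.weaken (hS (by omega))) (hn.weaken (hS (by omega)))⟩

end Prf

/-! ### Fresh variables -/

namespace Fml

/-- The variable `c` does not occur free in `φ`. -/
def Fresh (c : ℕ) (φ : Fml) : Prop :=
  ∀ f g : ℕ → ℕ, (∀ n, n ≠ c → f n = g n) → φ.rename f = φ.rename g

theorem FreeLt.fresh {φ : Fml} {n c : ℕ} (h : FreeLt n φ) (hc : n ≤ c) : Fresh c φ :=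
  fun _ _ hfg => h.rename_congr fun i hi => hfg i (by omega)

theorem fresh_rename {φ : Fml} {f : ℕ → ℕ} {c : ℕ} (hc : ∀ n, f n ≠ c) : Fresh c (φ.rename f) := by
  intro g h hgh
  simp only [rename_rename]
  congr 1
  exact funext fun n => hgh _ (hc n)

end Fml

/-- Elimination of an existential quantifier, with a fresh variable as witness. -/
theorem Prf.exE_fresh {Γ : Set Fml} {φ χ : Fml} {c : ℕ} (hΓ : ∀ γ ∈ Γ, Fresh c γ)
    (hφ : Fresh c (ex φ)) (hχ : Fresh c χ) (h : Prf Γ (ex φ))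
    (h' : Prf (insert (φ.inst c) Γ) χ) : Prf Γ χ := by
  -- This renaming moves the witness `c` to the bound position 0 and shifts the rest: it turns
  -- `φ.inst c` back into `φ` and acts as `shift` on formulas in which `c` is fresh.
  let g : ℕ → ℕ := fun n => if n = c then 0 else n + 1
  have hg : ∀ n, n ≠ c → g n = n + 1 := fun n hn => if_neg hn
  have hr : ∀ ψ, Fresh c ψ → ψ.rename g = ψ.shift := fun ψ hψ => hψ _ _ hg
  have hi : (φ.inst c).rename g = φ := by
    have h1 := hφ (fun n => if n = c then 0 else n + 1) (fun n => n + 1) fun n hn => if_neg hn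
    simp only [Fml.rename, Fml.ex.injEq] at h1
    have h2 := congrArg (fun ψ => Fml.inst ψ 0) h1
    simp only [Fml.inst, rename_rename] at h2
    rw [Fml.inst, rename_rename]
    convert h2 using 1
    · congr 1
      funext n
      cases n <;> simp [up, g]
    · conv_lhs => rw [← rename_id φ]
      congr 1
      funext n
      cases n <;> simp [up]
  refine h.exE ?_
  have := h'.rename g
  rw [Set.image_insert_eq, hi, hr χ hχ] at this
  refine this.weaken (Set.insert_subset_insert ?_)
  rintro _ ⟨γ, hγ, rfl⟩
  exact ⟨γ, hγ, (hr γ (hΓ γ hγ)).symm⟩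

/-! ### Saturated sets of formulas -/

namespace Fml

/-- A numbering of formulas. -/
def code : Fml → ℕ
  | bot => Nat.pair 0 0
  | mem x y => Nat.pair 1 (Nat.pair x y)
  | eq x y => Nat.pair 2 (Nat.pair x y)
  | conj φ ψ => Nat.pair 3 (Nat.pair φ.code ψ.code)
  | disj φ ψ => Nat.pair 4 (Nat.pair φ.code ψ.code)
  | imp φ ψ => Nat.pair 5 (Nat.pair φ.code ψ.code)
  | all φ => Nat.pair 6 φ.code
  | ex φ => Nat.pair 7 φ.code

theorem code_injective : Function.Injective code := by
  intro φ
  induction φ with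
  | bot => intro ψ h; cases ψ <;> simp_all [code, Nat.pair_eq_pair]
  | mem => intro ψ h; cases ψ <;> simp_all [code, Nat.pair_eq_pair]
  | eq => intro ψ h; cases ψ <;> simp_all [code, Nat.pair_eq_pair]
  | conj _ _ h₁ h₂ =>
    intro ψ h
    cases ψ <;> simp [code, Nat.pair_eq_pair] at h
    simp [h₁ h.1, h₂ h.2]
  | disj _ _ h₁ h₂ =>
    intro ψ h
    cases ψ <;> simp [code, Nat.pair_eq_pair] at h
    simp [h₁ h.1, h₂ h.2]
  | imp _ _ h₁ h₂ =>
    intro ψ h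
    cases ψ <;> simp [code, Nat.pair_eq_pair] at h
    simp [h₁ h.1, h₂ h.2]
  | all _ ih =>
    intro ψ h
    cases ψ <;> simp [code, Nat.pair_eq_pair] at h
    simp [ih h]
  | ex _ ih =>
    intro ψ h
    cases ψ <;> simp [code, Nat.pair_eq_pair] at h
    simp [ih h]

instance : Countable Fml := code_injective.countable

instance : Inhabited Fml := ⟨bot⟩

end Fml

/-- A consistent deductively closed set of formulas with the disjunction and the existence
property. -/
structure Saturated (Γ : Set Fml) : Prop where
  closed : ∀ {φ}, Prf Γ φ → φ ∈ Γ
  bot_notMem : bot ∉ Γ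
  disj : ∀ {φ ψ}, φ ⋎ ψ ∈ Γ → φ ∈ Γ ∨ ψ ∈ Γ
  ex : ∀ {φ}, Fml.ex φ ∈ Γ → ∃ t, φ.inst t ∈ Γ

/-- The formula `θ`, if derivable from `Γ`, is witnessed in `Δ`. -/
def Witnessed (Γ Δ : Set Fml) (θ : Fml) : Prop :=
  Prf Γ θ → (∀ φ ψ, θ = φ ⋎ ψ → φ ∈ Δ ∨ ψ ∈ Δ) ∧ ∀ φ, θ = ex φ → ∃ t, φ.inst t ∈ Δ

/-- One Henkin step. If both disjuncts proved `χ`, so would the disjunction, so one of them can be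
added safely; an existential formula is instantiated at a fresh variable. In the remaining cases a
harmless formula is added. -/
theorem exists_witnessed {Γ : Set Fml} {χ : Fml}
    (hf : ∀ θ, ∃ c, (∀ γ ∈ Γ, Fresh c γ) ∧ Fresh c χ ∧ Fresh c θ) (h : ¬ Prf Γ χ) (θ : Fml) :
    ∃ δ, ¬ Prf (insert δ Γ) χ ∧ Witnessed Γ (insert δ Γ) θ := by
  by_cases hθ : Prf Γ θ
  swap
  · exact ⟨bot ⟹ bot, fun hp => h ((Prf.impI (Prf.hyp (Set.mem_insert _ _))).cut hp),
      fun h' => absurd h' hθ⟩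
  cases θ with
  | disj φ ψ =>
    by_cases hφ : Prf (insert φ Γ) χ
    · exact ⟨ψ, fun hψ => h (hθ.disjE hφ hψ), fun _ => ⟨by simp +contextual, by simp⟩⟩
    · exact ⟨φ, hφ, fun _ => ⟨by simp +contextual, by simp⟩⟩
  | ex φ =>
    obtain ⟨c, h1, h2, h3⟩ := hf (ex φ)
    refine ⟨φ.inst c, fun hp => h (hθ.exE_fresh h1 h3 h2 hp), fun _ => ⟨by simp, ?_⟩⟩
    rintro _ ⟨⟩
    exact ⟨c, Set.mem_insert _ _⟩
  | _ => exact ⟨_, fun hp => h (hθ.cut hp), fun _ => ⟨by simp, by simp⟩⟩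

/-- Henkin construction: formulas are added one at a time, `χ` stays underivable, and the deductive
closure of the union is saturated. -/
theorem exists_saturated {Γ : Set Fml} {χ : Fml} (h : ¬ Prf Γ χ) :
    ∃ (f : ℕ → ℕ) (Δ : Set Fml), Saturated Δ ∧ (∀ φ ∈ Γ, φ.rename f ∈ Δ) ∧ χ.rename f ∉ Δ := by
  -- Moving all variables to even numbers frees the odd ones as witnesses; each stage adds only
  -- finitely many formulas, so a fresh odd variable always remains.
  let f : ℕ → ℕ := fun n => 2 * n
  let base := rename f '' Γ
  let χ' := χ.rename f
  have h0 : ¬ Prf base χ' := fun hp =>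
    h (hp.of_rename (g := fun n => n / 2) (funext fun n => by simp [f]))
  have hfresh (F : Set Fml) (hF : F.Finite) (θ : Fml) :
      ∃ c, (∀ γ ∈ base ∪ F, Fresh c γ) ∧ Fresh c χ' ∧ Fresh c θ := by
    have hN : ∃ N, ∀ γ ∈ F, FreeLt N γ := by
      induction F, hF using Set.Finite.induction_on with
      | empty => exact ⟨0, by simp⟩
      | @insert a s _ _ ih =>
        obtain ⟨N, hN⟩ := ih
        obtain ⟨M, hM⟩ := exists_freeLt a
        refine ⟨N + M, ?_⟩
        rintro γ (rfl | hγ)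
        · exact hM.mono (by omega)
        · exact (hN γ hγ).mono (by omega)
    obtain ⟨N, hN⟩ := hN
    obtain ⟨M, hM⟩ := exists_freeLt θ
    refine ⟨2 * (N + M) + 1, ?_, fresh_rename fun n => ?_, hM.fresh (by omega)⟩
    · rintro γ (⟨γ, -, rfl⟩ | hγ)
      · exact fresh_rename fun n => by simp only [f]; omega
      · exact (hN γ hγ).fresh (by omega)
    · simp only [f]; omega
  let Stage := {F : Set Fml // F.Finite ∧ ¬ Prf (base ∪ F) χ'}
  have step (F : Stage) (θ : Fml) : ∃ G : Stage, base ∪ F.1 ⊆ base ∪ G.1 ∧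
      Witnessed (base ∪ F.1) (base ∪ G.1) θ := by
    obtain ⟨δ, h1, h2⟩ := exists_witnessed (hfresh F.1 F.2.1) F.2.2 θ
    rw [← Set.union_insert] at h1 h2
    exact ⟨⟨insert δ F.1, F.2.1.insert δ, h1⟩,
      Set.union_subset_union_right _ (Set.subset_insert _ _), h2⟩
  choose next hsub hwit using step
  obtain ⟨e, he⟩ := exists_surjective_nat Fml
  -- Stage `k` treats the formula numbered by the first component of `k`, so each formula recurs. A
  -- formula with number `i` derivable at stage `n` is treated at stage `Nat.pair i n ≥ n`.
  let S : ℕ → Stage := fun n => n.rec ⟨∅, Set.finite_empty, by simpa using h0⟩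
    fun n F => next F (e n.unpair.1)
  have hmono : Monotone fun n => base ∪ (S n).1 := monotone_nat_of_le_succ fun n => hsub _ _
  let U := ⋃ n, base ∪ (S n).1
  have hU {φ : Fml} (hφ : Prf U φ) : ∃ n, Prf (base ∪ (S n).1) φ :=
    hφ.exists_stage _ hmono subset_rfl
  have key {θ : Fml} (hθ : Prf U θ) : Witnessed U U θ := by
    intro _
    obtain ⟨n, hn⟩ := hU hθ
    obtain ⟨i, rfl⟩ := he θ
    have hw := hwit (S (Nat.pair i n)) (e i)
      (hn.weaken (hmono (Nat.right_le_pair i n)))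
    have hs : base ∪ (next (S (Nat.pair i n)) (e i)).1 ⊆ U := by
      have : next (S (Nat.pair i n)) (e i) = S (Nat.pair i n + 1) := by
        simp [S, Nat.unpair_pair]
      rw [this]
      exact Set.subset_iUnion (fun n => base ∪ (S n).1) (Nat.pair i n + 1)
    exact ⟨fun φ ψ h => (hw.1 φ ψ h).imp (fun h => hs h) fun h => hs h,
      fun φ h => (hw.2 φ h).imp fun t h => hs h⟩
  -- Cut for a possibly infinite set of assumptions, by induction on the derivation.
  have hcl {φ : Fml} (hφ : Prf {ψ | Prf U ψ} φ) : Prf U φ := by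
    suffices H : ∀ (Γ : Set Fml) (φ : Fml), Prf Γ φ → ∀ Δ, (∀ γ ∈ Γ, Prf Δ γ) → Prf Δ φ from
      H _ φ hφ _ fun _ h => h
    have ins (α : Fml) {Γ Δ : Set Fml} (h : ∀ γ ∈ Γ, Prf Δ γ) :
        ∀ γ ∈ insert α Γ, Prf (insert α Δ) γ := by
      rintro γ (rfl | hγ)
      · exact Prf.hyp (Set.mem_insert _ _)
      · exact (h γ hγ).weaken (Set.subset_insert _ _)
    have shf {Γ Δ : Set Fml} (h : ∀ γ ∈ Γ, Prf Δ γ) : ∀ γ ∈ shift '' Γ, Prf (shift '' Δ) γ := by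
      rintro _ ⟨γ, hγ, rfl⟩
      exact (h γ hγ).rename _
    intro Γ φ h
    induction h with
    | hyp h => exact fun Δ hΔ => hΔ _ h
    | botE _ ih => exact fun Δ hΔ => (ih Δ hΔ).botE
    | conjI _ _ h₁ h₂ => exact fun Δ hΔ => (h₁ Δ hΔ).conjI (h₂ Δ hΔ)
    | conjE₁ _ ih => exact fun Δ hΔ => (ih Δ hΔ).conjE₁
    | conjE₂ _ ih => exact fun Δ hΔ => (ih Δ hΔ).conjE₂
    | disjI₁ _ ih => exact fun Δ hΔ => (ih Δ hΔ).disjI₁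
    | disjI₂ _ ih => exact fun Δ hΔ => (ih Δ hΔ).disjI₂
    | disjE _ _ _ h h₁ h₂ =>
      exact fun Δ hΔ => (h Δ hΔ).disjE (h₁ _ (ins _ hΔ)) (h₂ _ (ins _ hΔ))
    | impI _ ih => exact fun Δ hΔ => (ih _ (ins _ hΔ)).impI
    | impE _ _ h₁ h₂ => exact fun Δ hΔ => (h₁ Δ hΔ).impE (h₂ Δ hΔ)
    | allI _ ih => exact fun Δ hΔ => (ih _ (shf hΔ)).allI
    | allE t _ ih => exact fun Δ hΔ => (ih Δ hΔ).allE t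
    | exI t _ ih => exact fun Δ hΔ => (ih Δ hΔ).exI t
    | exE _ _ h₁ h₂ => exact fun Δ hΔ => (h₁ Δ hΔ).exE (h₂ _ (ins _ (shf hΔ)))
    | eqRefl t => exact fun Δ _ => .eqRefl t
    | eqSubst _ _ h₁ h₂ => exact fun Δ hΔ => (h₁ Δ hΔ).eqSubst (h₂ Δ hΔ)
  have hχ : ¬ Prf U χ' := fun hp => by
    obtain ⟨n, hn⟩ := hU hp
    exact (S n).2.2 hn
  refine ⟨f, {ψ | Prf U ψ}, ⟨hcl, fun hb => hχ (Prf.botE hb), fun {φ ψ} h => ?_, fun {φ} h => ?_⟩,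
    fun φ hφ => ?_, hχ⟩
  · exact ((key h h).1 φ ψ rfl).imp Prf.hyp Prf.hyp
  · exact ((key h h).2 φ rfl).imp fun t => Prf.hyp
  · exact Prf.hyp (Set.mem_iUnion.2 ⟨0, Or.inl ⟨φ, hφ, rfl⟩⟩)

/-! ### Kripke models -/

/-- A Kripke model for the language of set theory, in presheaf form: a category of worlds, a set of
individuals at each world, and transition maps that preserve membership. Equality is interpreted
as equality. -/
structure Model where
  World : Type
  Hom : World → World → Type
  id (w : World) : Hom w w
  comp {u v w : World} : Hom u v → Hom v w → Hom u w
  Obj : World → Type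
  map {v w : World} : Hom v w → Obj v → Obj w
  map_id {w : World} (x : Obj w) : map (id w) x = x
  map_comp {u v w : World} (f : Hom u v) (g : Hom v w) (x : Obj u) :
    map (comp f g) x = map g (map f x)
  mem {w : World} : Obj w → Obj w → Prop
  mem_map {v w : World} (f : Hom v w) {x y : Obj v} : mem x y → mem (map f x) (map f y)

/-- Extension of a valuation by a value for the variable `0`. -/
def cons {α : Type} (d : α) (v : ℕ → α) : ℕ → α
  | 0 => d
  | n + 1 => v n

@[simp] theorem cons_zero {α : Type} (d : α) (v : ℕ → α) : cons d v 0 = d := rfl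

@[simp] theorem cons_succ {α : Type} (d : α) (v : ℕ → α) (n : ℕ) : cons d v (n + 1) = v n := rfl

attribute [simp] Model.map_id Model.map_comp

/-- The forcing relation. -/
def Model.force (K : Model) : Fml → {w : K.World} → (ℕ → K.Obj w) → Prop
  | .bot, _, _ => False
  | .mem x y, _, v => K.mem (v x) (v y)
  | .eq x y, _, v => v x = v y
  | .conj φ ψ, _, v => K.force φ v ∧ K.force ψ v
  | .disj φ ψ, _, v => K.force φ v ∨ K.force ψ v
  | .imp φ ψ, w, v => ∀ (w' : K.World) (f : K.Hom w w'),
      K.force φ (fun n => K.map f (v n)) → K.force ψ (fun n => K.map f (v n))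
  | .all φ, w, v => ∀ (w' : K.World) (f : K.Hom w w') (d : K.Obj w'),
      K.force φ (cons d fun n => K.map f (v n))
  | .ex φ, _, v => ∃ d, K.force φ (cons d v)

/-! ### Completeness -/

section Canonical

variable (Γ₀ : Set Fml)

/-- Worlds of the canonical model of `Γ₀`: saturated sets that contain `Γ₀` up to a renaming. -/
structure CanonicalWorld where
  carrier : Set Fml
  saturated : Saturated carrier
  base : ℕ → ℕ
  base_mem : ∀ φ ∈ Γ₀, φ.rename base ∈ carrier

variable {Γ₀}

namespace CanonicalWorld

/-- The interpretation of equality at a world. -/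
def setoid (w : CanonicalWorld Γ₀) : Setoid ℕ where
  r s t := eq s t ∈ w.carrier
  iseqv :=
    { refl := fun t => w.saturated.closed (.eqRefl t)
      symm := fun {s t} h => w.saturated.closed
        (Prf.eqSubst (φ := eq 0 (s + 1)) (s := s) (t := t) (.hyp h) (.eqRefl s))
      trans := fun {r s t} h h' => w.saturated.closed
        (Prf.eqSubst (φ := eq (r + 1) 0) (s := s) (t := t) (.hyp h') (.hyp h)) }

/-- The individual denoted by a variable. -/
def den (w : CanonicalWorld Γ₀) (t : ℕ) : Quotient w.setoid := Quotient.mk _ t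

theorem den_eq {w : CanonicalWorld Γ₀} {s t : ℕ} : w.den s = w.den t ↔ eq s t ∈ w.carrier :=
  Quotient.eq (r := w.setoid)

theorem den_surjective (w : CanonicalWorld Γ₀) : Function.Surjective w.den := Quotient.mk_surjective

theorem mem_congr (w : CanonicalWorld Γ₀) {s s' t t' : ℕ} (hs : eq s s' ∈ w.carrier)
    (ht : eq t t' ∈ w.carrier) (h : mem s t ∈ w.carrier) : mem s' t' ∈ w.carrier :=
  w.saturated.closed
    (Prf.eqSubst (φ := mem (s' + 1) 0) (s := t) (t := t') (.hyp ht)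
      (Prf.eqSubst (φ := mem 0 (t + 1)) (s := s) (t := s') (.hyp hs) (.hyp h)))

end CanonicalWorld

open CanonicalWorld

variable (Γ₀) in
/-- The canonical model. -/
def canonical : Model where
  World := CanonicalWorld Γ₀
  -- Compatibility with `base` makes the denotations of `base n` stable under transition; they
  -- interpret the parameters in `Prf.of_force`.
  Hom v w := {f : ℕ → ℕ // (∀ φ ∈ v.carrier, φ.rename f ∈ w.carrier) ∧ f ∘ v.base = w.base}
  id w := ⟨_root_.id, fun φ h => by rwa [rename_id], rfl⟩
  comp f g := ⟨g.1 ∘ f.1, fun φ h => by rw [← rename_rename]; exact g.2.1 _ (f.2.1 _ h), by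
    rw [Function.comp_assoc, f.2.2, g.2.2]⟩
  Obj w := Quotient w.setoid
  map {v w} f := Quotient.map' (s₁ := v.setoid) (s₂ := w.setoid) f.1 fun s t h => f.2.1 (eq s t) h
  map_id x := by
    induction x using Quotient.inductionOn'
    rfl
  map_comp f g x := by
    induction x using Quotient.inductionOn'
    rfl
  mem {w} := Quotient.lift₂ (s₁ := w.setoid) (s₂ := w.setoid) (fun s t => mem s t ∈ w.carrier)
    fun s t s' t' hs ht => propext ⟨w.mem_congr hs ht,
      w.mem_congr (w.setoid.symm hs) (w.setoid.symm ht)⟩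
  mem_map f x y := by
    induction x using Quotient.inductionOn'
    induction y using Quotient.inductionOn'
    exact f.2.1 (mem _ _)

theorem inst_rename_up (φ : Fml) (f : ℕ → ℕ) (t : ℕ) :
    (φ.rename (up f)).inst t = φ.rename (cons t f) := by
  simp only [Fml.inst, rename_rename]
  congr 1
  funext n
  cases n <;> rfl

/-- The truth lemma. For implication and universal quantification, an underivable formula is refuted
at a later world supplied by `exists_saturated`; the disjunction and existence properties handle
`disj` and `ex`. -/
theorem force_canonical (φ : Fml) {w : CanonicalWorld Γ₀} {v : ℕ → (canonical Γ₀).Obj w}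
    {f : ℕ → ℕ} (hv : ∀ n, v n = w.den (f n)) :
    (canonical Γ₀).force φ v ↔ φ.rename f ∈ w.carrier := by
  have hp {w : CanonicalWorld Γ₀} {φ : Fml} : Prf w.carrier φ ↔ φ ∈ w.carrier :=
    ⟨w.saturated.closed, .hyp⟩
  have hmap {w w' : CanonicalWorld Γ₀} {v : ℕ → (canonical Γ₀).Obj w} {f : ℕ → ℕ}
      (hv : ∀ n, v n = w.den (f n)) (g : (canonical Γ₀).Hom w w') (n : ℕ) :
      (canonical Γ₀).map g (v n) = w'.den ((g.1 ∘ f) n) := by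
    rw [hv]
    rfl
  have hcons {w : CanonicalWorld Γ₀} {v : ℕ → (canonical Γ₀).Obj w} {f : ℕ → ℕ}
      (hv : ∀ n, v n = w.den (f n)) (t n : ℕ) : cons (w.den t) v n = w.den (cons t f n) := by
    cases n
    · rfl
    · exact hv _
  induction φ generalizing w v f with
  | bot => exact ⟨False.elim, w.saturated.bot_notMem⟩
  | mem x y =>
    simp only [Model.force, hv]
    exact Iff.rfl
  | eq x y =>
    simp only [Model.force, hv]
    exact den_eq
  | conj φ ψ h₁ h₂ =>
    refine (and_congr (h₁ hv) (h₂ hv)).trans ⟨fun h => ?_, fun h => ⟨?_, ?_⟩⟩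
    · exact hp.1 ((hp.2 h.1).conjI (hp.2 h.2))
    · exact hp.1 (hp.2 h).conjE₁
    · exact hp.1 (hp.2 h).conjE₂
  | disj φ ψ h₁ h₂ =>
    refine (or_congr (h₁ hv) (h₂ hv)).trans ⟨?_, fun h => w.saturated.disj h⟩
    rintro (h | h)
    · exact hp.1 (hp.2 h).disjI₁
    · exact hp.1 (hp.2 h).disjI₂
  | imp φ ψ h₁ h₂ =>
    constructor
    · intro h
      by_contra hn
      have : ¬ Prf (insert (φ.rename f) w.carrier) (ψ.rename f) := fun h => hn (hp.1 h.impI)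
      obtain ⟨g, Δ, hΔ, hs, hψ⟩ := exists_saturated this
      let w' : CanonicalWorld Γ₀ := ⟨Δ, hΔ, g ∘ w.base, fun φ hφ => by
        rw [← rename_rename]
        exact hs _ (Or.inr (w.base_mem φ hφ))⟩
      let g' : (canonical Γ₀).Hom w w' := ⟨g, fun φ hφ => hs _ (Or.inr hφ), rfl⟩
      rw [rename_rename] at hψ
      refine hψ ((h₂ (hmap hv g')).1 (h w' g' ((h₁ (hmap hv g')).2 ?_)))
      rw [← rename_rename]
      exact hs _ (Or.inl rfl)
    · intro h w' g h'
      have h' := (h₁ (hmap hv g)).1 h'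
      have h := g.2.1 _ h
      rw [rename_rename] at h
      exact (h₂ (hmap hv g)).2 (hp.1 ((hp.2 h).impE (hp.2 h')))
  | all φ ih =>
    constructor
    · intro h
      by_contra hn
      have : ¬ Prf (shift '' w.carrier) (φ.rename (up f)) := fun h => hn (hp.1 h.allI)
      obtain ⟨g, Δ, hΔ, hs, hψ⟩ := exists_saturated this
      have hs' : ∀ φ ∈ w.carrier, φ.rename (g ∘ Nat.succ) ∈ Δ := fun φ hφ => by
        rw [← rename_rename]
        exact hs _ ⟨φ, hφ, rfl⟩
      let w' : CanonicalWorld Γ₀ := ⟨Δ, hΔ, (g ∘ Nat.succ) ∘ w.base, fun φ hφ => by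
        rw [← rename_rename]
        exact hs' _ (w.base_mem φ hφ)⟩
      let g' : (canonical Γ₀).Hom w w' := ⟨g ∘ Nat.succ, hs', rfl⟩
      -- Variable 0 is the eigenvariable missing from the shifted assumptions; its image `g 0` is
      -- the counterexample.
      have h := (ih (hcons (hmap hv g') (g 0))).1 (h w' g' (w'.den (g 0)))
      rw [rename_rename] at hψ
      refine hψ ?_
      convert h using 2
      funext n
      cases n <;> rfl
    · intro h w' g d
      obtain ⟨t, rfl⟩ := den_surjective w' d
      have h := g.2.1 _ h
      rw [rename_rename] at h
      refine (ih (hcons (hmap hv g) t)).2 ?_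
      rw [← inst_rename_up]
      exact hp.1 ((hp.2 h).allE t)
  | ex φ ih =>
    constructor
    · rintro ⟨d, h⟩
      obtain ⟨t, rfl⟩ := w.den_surjective d
      have h := (ih (hcons hv t)).1 h
      rw [← inst_rename_up] at h
      exact hp.1 ((hp.2 h).exI t)
    · intro h
      obtain ⟨t, ht⟩ := w.saturated.ex h
      rw [inst_rename_up] at ht
      exact ⟨w.den t, (ih (hcons hv t)).2 ht⟩

/-- Completeness for Kripke models with a global choice of parameters. -/
theorem Prf.of_force {Γ : Set Fml} {χ : Fml}
    (h : ∀ (K : Model) (ρ : ∀ w, ℕ → K.Obj w),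
      (∀ {v w : K.World} (f : K.Hom v w) (n : ℕ), K.map f (ρ v n) = ρ w n) →
      (∀ φ ∈ Γ, ∀ w, K.force φ (ρ w)) → ∀ w, K.force χ (ρ w)) : Prf Γ χ := by
  by_contra hn
  obtain ⟨f, Δ, hΔ, hs, hχ⟩ := exists_saturated hn
  refine hχ ((force_canonical χ (w := ⟨Δ, hΔ, f, hs⟩) fun _ => rfl).1 ?_)
  refine h (canonical Γ) (fun w n => w.den (w.base n)) ?_ ?_ _
  · intro v w g n
    exact congrArg w.den (congrFun g.2.2 n)
  · intro φ hφ w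
    exact (force_canonical φ (w := w) fun _ => rfl).2 (w.base_mem φ hφ)

end Canonical

/-! ### Basic properties of forcing -/

namespace Model

variable (K : Model) {w : K.World}

theorem map_cons {w' : K.World} (f : K.Hom w w') (d : K.Obj w) (v : ℕ → K.Obj w) :
    (fun n => K.map f (cons d v n)) = cons (K.map f d) fun n => K.map f (v n) := by
  funext n
  cases n <;> rfl

theorem force_rename (φ : Fml) (g : ℕ → ℕ) (v : ℕ → K.Obj w) :
    K.force (φ.rename g) v ↔ K.force φ fun n => v (g n) := by
  have hup {w : K.World} (g : ℕ → ℕ) (d : K.Obj w) (v : ℕ → K.Obj w) :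
      (fun n => cons d v (up g n)) = cons d fun n => v (g n) := by
    funext n
    cases n <;> rfl
  induction φ generalizing w g <;> simp_all [Fml.rename, force]

theorem force_congr {φ : Fml} {n : ℕ} (h : FreeLt n φ) {v v' : ℕ → K.Obj w}
    (hv : ∀ i < n, v i = v' i) : K.force φ v ↔ K.force φ v' := by
  have hcons {w : K.World} {v v' : ℕ → K.Obj w} {n : ℕ} (hv : ∀ i < n, v i = v' i) (d : K.Obj w) :
      ∀ i < n + 1, cons d v i = cons d v' i := by
    rintro (_ | i) hi
    · rfl
    · exact hv i (by omega)
  have hmap {w w' : K.World} {v v' : ℕ → K.Obj w} {n : ℕ} (hv : ∀ i < n, v i = v' i)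
      (f : K.Hom w w') : ∀ i < n, K.map f (v i) = K.map f (v' i) := fun i hi => by rw [hv i hi]
  induction φ generalizing w n with
  | bot => exact Iff.rfl
  | mem x y => simp only [force, hv _ h.1, hv _ h.2]
  | eq x y => simp only [force, hv _ h.1, hv _ h.2]
  | conj _ _ h₁ h₂ => exact and_congr (h₁ h.1 hv) (h₂ h.2 hv)
  | disj _ _ h₁ h₂ => exact or_congr (h₁ h.1 hv) (h₂ h.2 hv)
  | imp _ _ h₁ h₂ =>
    exact forall_congr' fun w' => forall_congr' fun f =>
      imp_congr (h₁ h.1 (hmap hv f)) (h₂ h.2 (hmap hv f))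
  | all _ ih =>
    exact forall_congr' fun w' => forall_congr' fun f => forall_congr' fun d =>
      ih h (hcons (hmap hv f) d)
  | ex _ ih => exact exists_congr fun d => ih h (hcons hv d)

theorem force_map {φ : Fml} {v : ℕ → K.Obj w} (h : K.force φ v) {w' : K.World}
    (f : K.Hom w w') : K.force φ fun n => K.map f (v n) := by
  induction φ generalizing w w' with
  | bot => exact h
  | mem x y => exact K.mem_map f h
  | eq x y => exact congrArg (K.map f) h
  | conj _ _ h₁ h₂ => exact ⟨h₁ h.1 f, h₂ h.2 f⟩
  | disj _ _ h₁ h₂ => exact h.imp (h₁ · f) (h₂ · f)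
  | imp _ _ h₁ h₂ =>
    intro w'' g h'
    simp only [← map_comp] at h' ⊢
    exact h _ _ h'
  | all _ ih =>
    intro w'' g d
    simp only [← map_comp]
    exact h _ _ d
  | ex _ ih =>
    obtain ⟨d, hd⟩ := h
    exact ⟨K.map f d, by simpa [map_cons] using ih hd f⟩

section

variable {K} {v : ℕ → K.Obj w}

@[simp] theorem force_mem {x y : ℕ} : K.force (Fml.mem x y) v ↔ K.mem (v x) (v y) := Iff.rfl

@[simp] theorem force_eq {x y : ℕ} : K.force (eq x y) v ↔ v x = v y := Iff.rfl

@[simp] theorem force_conj {φ ψ : Fml} : K.force (φ ⋏ ψ) v ↔ K.force φ v ∧ K.force ψ v := Iff.rfl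

@[simp] theorem force_disj {φ ψ : Fml} : K.force (φ ⋎ ψ) v ↔ K.force φ v ∨ K.force ψ v := Iff.rfl

@[simp] theorem force_ex {φ : Fml} : K.force (ex φ) v ↔ ∃ d, K.force φ (cons d v) := Iff.rfl

theorem force_imp {φ ψ : Fml} : K.force (φ ⟹ ψ) v ↔ ∀ (w' : K.World) (f : K.Hom w w'),
    K.force φ (fun n => K.map f (v n)) → K.force ψ (fun n => K.map f (v n)) := Iff.rfl

theorem force_imp_self {φ ψ : Fml} (h : K.force (φ ⟹ ψ) v) (h' : K.force φ v) : K.force ψ v := by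
  simpa [map_cons] using h w (K.id w) (by simpa [map_cons] using h')

theorem force_neg {φ : Fml} : K.force (neg φ) v ↔ ∀ (w' : K.World) (f : K.Hom w w'),
    ¬ K.force φ (fun n => K.map f (v n)) := Iff.rfl

-- The quantifier already ranges over all later worlds, so by composing transitions the further
-- passage demanded by the implication is redundant.
@[simp] theorem force_all_imp {φ ψ : Fml} : K.force (all (φ ⟹ ψ)) v ↔
    ∀ (w' : K.World) (f : K.Hom w w') (d : K.Obj w'),
      K.force φ (cons d fun n => K.map f (v n)) → K.force ψ (cons d fun n => K.map f (v n)) := by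
  refine ⟨fun h w' f d => force_imp_self (h w' f d), fun h w' f d w'' g => ?_⟩
  simpa [map_cons] using h w'' (K.comp f g) (K.map g d)

@[simp] theorem force_all_iff {φ ψ : Fml} : K.force (all (iff φ ψ)) v ↔
    ∀ (w' : K.World) (f : K.Hom w w') (d : K.Obj w'),
      (K.force φ (cons d fun n => K.map f (v n)) ↔
        K.force ψ (cons d fun n => K.map f (v n))) := by
  have h₁ := force_all_imp (φ := φ) (ψ := ψ) (v := v)
  have h₂ := force_all_imp (φ := ψ) (ψ := φ) (v := v)
  refine ⟨fun h w' f d => ⟨h₁.1 (fun w' f d => (h w' f d).1) w' f d,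
    h₂.1 (fun w' f d => (h w' f d).2) w' f d⟩, fun h w' f d => ⟨?_, ?_⟩⟩
  · exact h₁.2 (fun w' f d => (h w' f d).1) w' f d
  · exact h₂.2 (fun w' f d => (h w' f d).2) w' f d

@[simp] theorem force_all_neg {φ : Fml} : K.force (all (neg φ)) v ↔
    ∀ (w' : K.World) (f : K.Hom w w') (d : K.Obj w'),
      ¬ K.force φ (cons d fun n => K.map f (v n)) := force_all_imp

theorem force_all_all {φ : Fml} : K.force (all (all φ)) v ↔
    ∀ (w' : K.World) (f : K.Hom w w') (d e : K.Obj w'),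
      K.force φ (cons e (cons d fun n => K.map f (v n))) := by
  refine ⟨fun h w' f d e => by simpa [map_cons] using h w' f d w' (K.id w') e, fun h w' f d w'' g e => ?_⟩
  simpa [map_cons] using h w'' (K.comp f g) (K.map g d) e

theorem force_all_all_imp {φ ψ : Fml} : K.force (all (all (φ ⟹ ψ))) v ↔
    ∀ (w' : K.World) (f : K.Hom w w') (d e : K.Obj w'),
      K.force φ (cons e (cons d fun n => K.map f (v n))) →
        K.force ψ (cons e (cons d fun n => K.map f (v n))) := by
  refine ⟨fun h w' f d e => force_imp_self (force_all_all.1 h w' f d e),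
    fun h => force_all_all.2 fun w' f d e w'' g => ?_⟩
  simpa [map_cons] using h w'' (K.comp f g) (K.map g d) (K.map g e)

theorem force_all_all_all_imp {φ ψ : Fml} : K.force (all (all (all (φ ⟹ ψ)))) v ↔
    ∀ (w' : K.World) (f : K.Hom w w') (c d e : K.Obj w'),
      K.force φ (cons e (cons d (cons c fun n => K.map f (v n)))) →
        K.force ψ (cons e (cons d (cons c fun n => K.map f (v n)))) := by
  refine ⟨fun h w' f c => ?_, fun h w' f c => force_all_all_imp.2 fun w'' g d e => ?_⟩
  · simpa [map_cons] using force_all_all_imp.1 (h w' f c) w' (K.id w')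
  · simpa [map_cons] using h w'' (K.comp f g) (K.map g c) d e

@[simp] theorem force_ball {t : ℕ} {φ : Fml} : K.force (ball t φ) v ↔
    ∀ (w' : K.World) (f : K.Hom w w') (d : K.Obj w'), K.mem d (K.map f (v t)) →
      K.force φ (cons d fun n => K.map f (v n)) := force_all_imp

@[simp] theorem force_bex {t : ℕ} {φ : Fml} : K.force (bex t φ) v ↔
    ∃ d : K.Obj w, K.mem d (v t) ∧ K.force φ (cons d v) := Iff.rfl

@[simp] theorem force_sub1 {φ : Fml} {x d : ℕ} :
    K.force (φ.sub1 x d) v ↔ K.force φ (cons (v x) fun k => v (k + d)) := by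
  rw [sub1, force_rename]
  apply iff_of_eq
  congr 1
  funext n
  cases n <;> rfl

@[simp] theorem force_sub2 {φ : Fml} {x y d : ℕ} :
    K.force (φ.sub2 x y d) v ↔ K.force φ (cons (v x) (cons (v y) fun k => v (k + d))) := by
  rw [sub2, force_rename]
  apply iff_of_eq
  congr 1
  funext n
  rcases n with _ | _ | n <;> rfl

end

/-- All formulas of `T` are forced at all worlds. -/
def Satisfies (T : Set Fml) : Prop :=
  ∀ φ ∈ T, ∀ (w : K.World) (v : ℕ → K.Obj w), K.force φ v

variable {K}

/-- Enough quantifiers make any formula a sentence; instantiating them along identity transitions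
recovers the formula at an arbitrary valuation. -/
theorem Satisfies.of_closures {S : Set Fml} (h : K.Satisfies (closures S)) : K.Satisfies S := by
  intro φ hφ
  obtain ⟨n, hn⟩ := exists_freeLt φ
  have hs : IsSentence (all^[n] φ) := by
    clear hφ
    induction n generalizing φ with
    | zero => exact hn
    | succ n ih => exact ih (all φ) hn
  have h := h _ ⟨hs, φ, hφ, n, rfl⟩
  clear hs hn hφ
  induction n generalizing φ with
  | zero => exact h
  | succ n ih =>
    intro w v
    convert ih (all φ) h w (fun k => v (k + 1)) w (K.id w) (v 0) using 1
    funext k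
    cases k <;> simp

/-! ### Set-theoretic notions in a model -/

/-- `x = ∅`. -/
def Emp (x : K.Obj w) : Prop := ∀ (w' : K.World) (f : K.Hom w w') (u : K.Obj w'),
  ¬ K.mem u (K.map f x)

/-- `z = {x, y}`. -/
def Pair (z x y : K.Obj w) : Prop := ∀ (w' : K.World) (f : K.Hom w w') (u : K.Obj w'),
  K.mem u (K.map f z) ↔ u = K.map f x ∨ u = K.map f y

/-- `p = ⟨x, y⟩`. -/
def OPair (p x y : K.Obj w) : Prop := ∀ (w' : K.World) (f : K.Hom w w') (u : K.Obj w'),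
  K.mem u (K.map f p) ↔ Pair u (K.map f x) (K.map f x) ∨ Pair u (K.map f x) (K.map f y)

/-- `⟨x, y⟩ ∈ r`. -/
def OMem (x y r : K.Obj w) : Prop := ∃ p, K.mem p r ∧ OPair p x y

/-- `a` is a function. -/
def Func (a : K.Obj w) : Prop :=
  (∀ (w' : K.World) (f : K.Hom w w') (u : K.Obj w'), K.mem u (K.map f a) →
    ∃ x y, OPair u x y) ∧
  ∀ (w' : K.World) (f : K.Hom w w') (x y z : K.Obj w'), OMem x y (K.map f a) →
    OMem x z (K.map f a) → y = z

/-- `p` is a stable subset of `1`. -/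
def Stable (p : K.Obj w) : Prop := ∀ (w' : K.World) (f : K.Hom w w') (u : K.Obj w'),
  K.mem u (K.map f p) ↔ Emp u ∧ ∀ (w'' : K.World) (g : K.Hom w' w''),
    ¬ ∀ (w₃ : K.World) (h : K.Hom w'' w₃),
      ¬ K.mem (K.map h (K.map g u)) (K.map h (K.map g (K.map f p)))

/-- The condition on a member `⟨b, a⟩` of a good set `g`. -/
def GoodAt (g b a : K.Obj w) : Prop :=
  Func a ∧ ∀ (w' : K.World) (f : K.Hom w w') (x p : K.Obj w'), OMem x p (K.map f a) →
    (∃ c, K.mem c (K.map f b) ∧ OMem c x (K.map f g)) ∧ Stable p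

/-- `g` is a good set of pairs. -/
def Good (g : K.Obj w) : Prop := ∀ (w' : K.World) (f : K.Hom w w') (b a : K.Obj w'),
  OMem b a (K.map f g) → GoodAt (K.map f g) b a

/-- `u ∈ V^Ω`. -/
def InVOmega (u : K.Obj w) : Prop := ∃ g b, Good g ∧ OMem b u g

section

variable {v : ℕ → K.Obj w}

@[simp] theorem force_isEmpty {x : ℕ} : K.force (isEmpty x) v ↔ Emp (v x) := by
  simp [isEmpty, Emp]

@[simp] theorem force_isPair {x y z : ℕ} : K.force (isPair z x y) v ↔ Pair (v z) (v x) (v y) := by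
  simp [isPair, Pair]

@[simp] theorem force_isOPair {x y p : ℕ} :
    K.force (isOPair p x y) v ↔ OPair (v p) (v x) (v y) := by
  simp [isOPair, OPair]

@[simp] theorem force_opairMem {x y r : ℕ} :
    K.force (opairMem x y r) v ↔ OMem (v x) (v y) (v r) := by
  simp [opairMem, OMem]

@[simp] theorem force_isFunction {a : ℕ} : K.force (isFunction a) v ↔ Func (v a) := by
  simp only [isFunction, force_conj, force_all_all_all_imp]
  simp [Func, cons]

@[simp] theorem force_isStable {p : ℕ} : K.force (isStable p) v ↔ Stable (v p) := by
  simp [isStable, Stable, force_neg, map_cons]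

@[simp] theorem force_isGood {g : ℕ} : K.force (isGood g) v ↔ Good (v g) := by
  simp only [isGood, force_conj, force_all_all_imp]
  simp [Good, GoodAt, cons, forall_and]

@[simp] theorem force_VOmega : K.force VOmega v ↔ InVOmega (v 0) := by
  simp [VOmega, InVOmega, cons]

end

end Model

namespace Model

variable {K : Model} {w w' : K.World}

/-! ### Persistence -/

theorem Pair.map {x y z : K.Obj w} (h : Pair z x y) (f : K.Hom w w') :
    Pair (K.map f z) (K.map f x) (K.map f y) := by
  intro w'' g
  simp only [← map_comp]
  exact h _ _

theorem OPair.map {x y p : K.Obj w} (h : OPair p x y) (f : K.Hom w w') :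
    OPair (K.map f p) (K.map f x) (K.map f y) := by
  intro w'' g
  simp only [← map_comp]
  exact h _ _

theorem OMem.map {x y r : K.Obj w} (h : OMem x y r) (f : K.Hom w w') :
    OMem (K.map f x) (K.map f y) (K.map f r) := by
  obtain ⟨p, hp, h⟩ := h
  exact ⟨K.map f p, K.mem_map f hp, h.map f⟩

theorem Func.map {a : K.Obj w} (h : Func a) (f : K.Hom w w') : Func (K.map f a) := by
  refine ⟨fun w'' g => ?_, fun w'' g => ?_⟩ <;> simp only [← map_comp]
  exacts [h.1 _ _, h.2 _ _]

theorem Good.map {g : K.Obj w} (h : Good g) (f : K.Hom w w') : Good (K.map f g) := by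
  intro w'' g
  simp only [← map_comp]
  exact h _ _

/-! ### Pairs -/

theorem Pair.mem_iff {x y z u : K.Obj w} (h : Pair z x y) : K.mem u z ↔ u = x ∨ u = y := by
  simpa using h w (K.id w) u

theorem Pair.left_mem {x y z : K.Obj w} (h : Pair z x y) : K.mem x z := h.mem_iff.2 (.inl rfl)

theorem Pair.right_mem {x y z : K.Obj w} (h : Pair z x y) : K.mem y z := h.mem_iff.2 (.inr rfl)

theorem OPair.mem_iff {x y p u : K.Obj w} (h : OPair p x y) :
    K.mem u p ↔ Pair u x x ∨ Pair u x y := by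
  simpa using h w (K.id w) u

/-- Extensionality, Pairing, Union and Empty Set hold in the model. -/
structure Basic (K : Model) : Prop where
  ext : ∀ {w : K.World} {x y : K.Obj w},
    (∀ (w' : K.World) (f : K.Hom w w') (u : K.Obj w'),
      K.mem u (K.map f x) ↔ K.mem u (K.map f y)) → x = y
  pair : ∀ {w : K.World} (x y : K.Obj w), ∃ z, Pair z x y
  union : ∀ {w : K.World} (a : K.Obj w), ∃ b, ∀ (w' : K.World) (f : K.Hom w w') (u : K.Obj w'),
    K.mem u (K.map f b) ↔ ∃ y, K.mem y (K.map f a) ∧ K.mem u y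
  empty : ∀ w : K.World, ∃ e : K.Obj w, Emp e

namespace Basic

variable (hK : Basic K)
include hK

theorem pair_unique {x y z z' : K.Obj w} (h : Pair z x y) (h' : Pair z' x y) : z = z' :=
  hK.ext fun w' f u => (h w' f u).trans (h' w' f u).symm

theorem emp_unique {x y : K.Obj w} (h : Emp x) (h' : Emp y) : x = y :=
  hK.ext fun w' f u => iff_of_false (h w' f u) (h' w' f u)

theorem exists_opair (x y : K.Obj w) : ∃ p, OPair p x y := by
  obtain ⟨s, hs⟩ := hK.pair x x
  obtain ⟨t, ht⟩ := hK.pair x y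
  obtain ⟨p, hp⟩ := hK.pair s t
  refine ⟨p, fun w' f u => (hp w' f u).trans (or_congr ?_ ?_)⟩
  · exact ⟨fun h => h ▸ hs.map f, fun h => hK.pair_unique h (hs.map f)⟩
  · exact ⟨fun h => h ▸ ht.map f, fun h => hK.pair_unique h (ht.map f)⟩

theorem exists_mem_left_right {x y p : K.Obj w} (h : OPair p x y) :
    ∃ t, K.mem t p ∧ K.mem x t ∧ K.mem y t := by
  obtain ⟨t, ht⟩ := hK.pair x y
  exact ⟨t, h.mem_iff.2 (.inr ht), ht.left_mem, ht.right_mem⟩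

theorem opair_inj {x y x' y' p : K.Obj w} (h : OPair p x y) (h' : OPair p x' y') :
    x = x' ∧ y = y' := by
  obtain ⟨s, hs⟩ := hK.pair x x
  obtain ⟨t, ht⟩ := hK.pair x y
  obtain ⟨t', ht'⟩ := hK.pair x' y'
  have hx : x = x' := by
    have hx' : K.mem x' s := by
      rcases h'.mem_iff.1 (h.mem_iff.2 (.inl hs)) with h1 | h1 <;> exact h1.left_mem
    exact (by simpa using hs.mem_iff.1 hx' : x' = x).symm
  subst hx
  have h1 : y = x ∨ y = y' := by
    rcases h'.mem_iff.1 (h.mem_iff.2 (.inr ht)) with h1 | h1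
    · exact .inl (by simpa using h1.mem_iff.1 ht.right_mem)
    · exact h1.mem_iff.1 ht.right_mem
  have h2 : y' = x ∨ y' = y := by
    rcases h.mem_iff.1 (h'.mem_iff.2 (.inr ht')) with h1 | h1
    · exact .inl (by simpa using h1.mem_iff.1 ht'.right_mem)
    · exact h1.mem_iff.1 ht'.right_mem
  exact ⟨rfl, by grind⟩

end Basic

/-! ### Closure of `V^Ω` -/

/-- The good set occurs only positively, in the existence of an earlier stage. -/
theorem GoodAt.mono {g g' b a : K.Obj w} (h : GoodAt g b a)
    (hg : ∀ (w' : K.World) (f : K.Hom w w') (p : K.Obj w'),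
      K.mem p (K.map f g) → K.mem p (K.map f g')) : GoodAt g' b a := by
  refine ⟨h.1, fun w' f x p hx => ?_⟩
  obtain ⟨⟨c, hc, q, hq, hcx⟩, hp⟩ := h.2 w' f x p hx
  exact ⟨⟨c, hc, q, hg w' f q hq, hcx⟩, hp⟩

theorem Good.goodAt {g b a : K.Obj w} (h : Good g) (hba : OMem b a g) : GoodAt g b a := by
  simpa using h w (K.id w) b a (by simpa using hba)

/-- If every element of the domain of `u` occurs in one of the good sets in `B`, then `u ∈ V^Ω`. -/
theorem Basic.inVOmega_of_cover (hK : Basic K) {u B : K.Obj w} (hu : Func u)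
    (hst : ∀ (w' : K.World) (f : K.Hom w w') (x p : K.Obj w'), OMem x p (K.map f u) → Stable p)
    (hB : ∀ (w' : K.World) (f : K.Hom w w') (g : K.Obj w'), K.mem g (K.map f B) → Good g)
    (hcov : ∀ (w' : K.World) (f : K.Hom w w') (x p : K.Obj w'), OMem x p (K.map f u) →
      ∃ g, K.mem g (K.map f B) ∧ ∃ b, OMem b x g) : InVOmega u := by
  -- The new stage is c = ⋃⋃⋃B: if ⟨b, x⟩ belongs to some member of `B`, then b ∈ {b, x} ∈ ⟨b, x⟩ ∈
  -- ⋃B, so b ∈ c. The new good set is g = ⋃B ∪ {⟨c, u⟩}.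
  obtain ⟨G, hG⟩ := hK.union B
  obtain ⟨G', hG'⟩ := hK.union G
  obtain ⟨c, hc⟩ := hK.union G'
  obtain ⟨q, hq⟩ := hK.exists_opair c u
  obtain ⟨s, hs⟩ := hK.pair q q
  obtain ⟨t, ht⟩ := hK.pair G s
  obtain ⟨g, hg⟩ := hK.union t
  have hmem (w' : K.World) (f : K.Hom w w') (p : K.Obj w') :
      K.mem p (K.map f g) ↔ (∃ y, K.mem y (K.map f B) ∧ K.mem p y) ∨ p = K.map f q := by
    rw [hg, ← hG]
    constructor
    · rintro ⟨y, hy, hp⟩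
      rcases (ht w' f y).1 hy with rfl | rfl
      · exact .inl hp
      · exact .inr (by simpa using (hs w' f p).1 hp)
    · rintro (h | h)
      · exact ⟨_, (ht w' f _).2 (.inl rfl), h⟩
      · exact ⟨_, (ht w' f _).2 (.inr rfl), (hs w' f p).2 (.inl h)⟩
  refine ⟨g, c, ?_, q, by simpa using (hmem w (K.id w) q).2 (.inr (by simp)), hq⟩
  rintro w' f b a ⟨p, hp, hpba⟩
  -- Old pairs remain good by monotonicity; for the new pair, the covering hypothesis puts the stage
  -- of each domain element into `c`.
  rcases (hmem w' f p).1 hp with ⟨y, hy, hpy⟩ | rfl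
  · refine ((hB w' f y hy).goodAt ⟨p, hpy, hpba⟩).mono fun w'' h r hr => ?_
    rw [← map_comp, hmem]
    refine .inl ⟨_, ?_, hr⟩
    rw [map_comp]
    exact K.mem_map h hy
  · obtain ⟨rfl, rfl⟩ := hK.opair_inj hpba (hq.map f)
    refine ⟨hu.map f, fun w'' h x p hx => ?_⟩
    simp only [← map_comp] at hx ⊢
    refine ⟨?_, hst _ _ x p hx⟩
    obtain ⟨y, hy, b, r, hr, hbx⟩ := hcov _ _ x p hx
    obtain ⟨d, hd, hbd, -⟩ := hK.exists_mem_left_right hbx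
    refine ⟨b, ?_, r, (hmem _ _ r).2 (.inl ⟨y, hy, hr⟩), hbx⟩
    exact (hc _ _ b).2 ⟨d, (hG' _ _ d).2 ⟨r, (hG _ _ r).2 ⟨y, hy, hr⟩, hd⟩, hbd⟩

/-! ### Submodels -/

/-- The submodel given by a persistent predicate. -/
abbrev sub (K : Model) (P : ∀ {w : K.World}, K.Obj w → Prop)
    (hP : ∀ {w w' : K.World} (f : K.Hom w w') {x : K.Obj w}, P x → P (K.map f x)) : Model where
  World := K.World
  Hom := K.Hom
  id := K.id
  comp := K.comp
  Obj w := {x : K.Obj w // P x}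
  map f x := ⟨K.map f x.1, hP f x.2⟩
  map_id x := Subtype.ext (K.map_id x.1)
  map_comp f g x := Subtype.ext (K.map_comp f g x.1)
  mem x y := K.mem x.1 y.1
  mem_map f _ _ h := K.mem_map f h

section Sub

variable {P : ∀ {w : K.World}, K.Obj w → Prop}
  {hP : ∀ {w w' : K.World} (f : K.Hom w w') {x : K.Obj w}, P x → P (K.map f x)}

/-- Individuals of the submodel as individuals of the model. -/
def val {w : K.World} (x : (K.sub P hP).Obj w) : K.Obj w := x.1

theorem val_injective {w : K.World} : Function.Injective (val (P := P) (hP := hP) (w := w)) :=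
  Subtype.val_injective

theorem val_inj {w : K.World} {x y : (K.sub P hP).Obj w} : val x = val y ↔ x = y :=
  val_injective.eq_iff

theorem mem_val {w : K.World} {x y : (K.sub P hP).Obj w} :
    K.mem (val x) (val y) ↔ (K.sub P hP).mem x y := Iff.rfl

theorem map_val {w w' : K.World} (f : K.Hom w w') (x : (K.sub P hP).Obj w) :
    K.map f (val x) = val ((K.sub P hP).map f x) := rfl

theorem exists_val {w : K.World} {x : K.Obj w} (h : P x) : ∃ y : (K.sub P hP).Obj w, val y = x :=
  ⟨⟨x, h⟩, rfl⟩

theorem prop_val {w : K.World} (x : (K.sub P hP).Obj w) : P (val x) := x.2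

variable (hT : ∀ {w : K.World} {x y : K.Obj w}, P x → K.mem y x → P y)

section

include hT

/-- By transitivity, members of an individual of the submodel are again in the submodel, so both
readings quantify over the same members. -/
theorem pair_val {w : K.World} {x y z : (K.sub P hP).Obj w} :
    Pair (val z) (val x) (val y) ↔ Pair z x y := by
  constructor
  · intro h w' f u
    have h := h w' f (val u)
    simp only [map_val, val_inj] at h
    exact h
  · intro h w' f u
    constructor
    · intro hu
      obtain ⟨u, rfl⟩ := exists_val (hP := hP) (hT (prop_val _) (map_val f _ ▸ hu))
      simpa only [map_val, val_inj] using (h w' f u).1 hu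
    · rintro (rfl | rfl)
      exacts [(h w' f _).2 (.inl rfl), (h w' f _).2 (.inr rfl)]

theorem emp_val {w : K.World} {x : (K.sub P hP).Obj w} : Emp (val x) ↔ Emp x := by
  constructor
  · exact fun h w' f u => h w' f (val u)
  · intro h w' f u hu
    obtain ⟨u, rfl⟩ := exists_val (hP := hP) (hT (prop_val _) (map_val f _ ▸ hu))
    exact h w' f u hu

variable (hK : Basic K) (hN : Basic (K.sub P hP))
include hK hN

/-- Pairing in the submodel, absoluteness and extensionality outside: the class is closed under true
pairs. -/
theorem exists_val_of_pair {w : K.World} {x y : (K.sub P hP).Obj w} {z : K.Obj w}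
    (h : Pair z (val x) (val y)) : ∃ z' : (K.sub P hP).Obj w, val z' = z := by
  obtain ⟨z', hz'⟩ := hN.pair x y
  exact ⟨z', hK.pair_unique ((pair_val hT).2 hz') h⟩

theorem opair_val {w : K.World} {x y p : (K.sub P hP).Obj w} :
    OPair (val p) (val x) (val y) ↔ OPair p x y := by
  have key {w : K.World} {x y u : (K.sub P hP).Obj w} :
      Pair (val u) (val x) (val x) ∨ Pair (val u) (val x) (val y) ↔ Pair u x x ∨ Pair u x y :=
    or_congr (pair_val hT) (pair_val hT)
  constructor
  · intro h w' f u
    have h := h w' f (val u)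
    simp only [map_val, key] at h
    exact h
  · intro h w' f u
    constructor
    · intro hu
      obtain ⟨u, rfl⟩ := exists_val (hP := hP) (hT (prop_val _) (map_val f _ ▸ hu))
      exact key.2 ((h w' f u).1 hu)
    · intro hu
      simp only [map_val] at hu
      obtain ⟨u, rfl⟩ : ∃ u' : (K.sub P hP).Obj w', val u' = u := by
        rcases hu with hu | hu <;> exact exists_val_of_pair hT hK hN hu
      exact (h w' f u).2 (key.1 hu)

omit hN in
theorem exists_val_of_opair {w : K.World} {x y : K.Obj w} {p : (K.sub P hP).Obj w}
    (h : OPair (val p) x y) : ∃ x' y' : (K.sub P hP).Obj w, val x' = x ∧ val y' = y := by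
  obtain ⟨t, ht, hx, hy⟩ := hK.exists_mem_left_right h
  have := hT (prop_val p) ht
  exact ⟨⟨x, hT this hx⟩, ⟨y, hT this hy⟩, rfl, rfl⟩

theorem omem_val {w : K.World} {x y r : (K.sub P hP).Obj w} :
    OMem (val x) (val y) (val r) ↔ OMem x y r := by
  constructor
  · rintro ⟨p, hp, h⟩
    obtain ⟨p, rfl⟩ := exists_val (hP := hP) (hT (prop_val _) hp)
    exact ⟨p, hp, (opair_val hT hK hN).1 h⟩
  · rintro ⟨p, hp, h⟩
    exact ⟨val p, hp, (opair_val hT hK hN).2 h⟩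

omit hN in
theorem exists_val_of_omem {w : K.World} {x y : K.Obj w} {r : (K.sub P hP).Obj w}
    (h : OMem x y (val r)) : ∃ x' y' : (K.sub P hP).Obj w, val x' = x ∧ val y' = y := by
  obtain ⟨p, hp, h⟩ := h
  obtain ⟨p, rfl⟩ := exists_val (hP := hP) (hT (prop_val _) hp)
  exact exists_val_of_opair hT hK h

theorem func_val {w : K.World} {a : (K.sub P hP).Obj w} : Func (val a) ↔ Func a := by
  have ho {w : K.World} {x y r : (K.sub P hP).Obj w} := omem_val hT hK hN (x := x) (y := y) (r := r)
  constructor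
  · refine fun h => ⟨fun w' f u hu => ?_, fun w' f x y z hy hz => ?_⟩
    · obtain ⟨x, y, hxy⟩ := h.1 w' f (val u) hu
      obtain ⟨x, y, rfl, rfl⟩ := exists_val_of_opair hT hK hxy
      exact ⟨x, y, (opair_val hT hK hN).1 hxy⟩
    · exact val_injective (h.2 w' f (val x) (val y) (val z) (ho.2 hy) (ho.2 hz))
  · refine fun h => ⟨fun w' f u hu => ?_, fun w' f x y z hy hz => ?_⟩
    · obtain ⟨u, rfl⟩ := exists_val (hP := hP) (hT (prop_val _) (map_val f _ ▸ hu))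
      obtain ⟨x, y, hxy⟩ := h.1 w' f u hu
      exact ⟨val x, val y, (opair_val hT hK hN).2 hxy⟩
    · rw [map_val] at hy hz
      obtain ⟨x, y, rfl, rfl⟩ := exists_val_of_omem hT hK hy
      obtain ⟨-, z, -, rfl⟩ := exists_val_of_omem hT hK hz
      exact congrArg val (h.2 w' f x y z (ho.1 hy) (ho.1 hz))

theorem stable_val {w : K.World} {p : (K.sub P hP).Obj w} : Stable (val p) ↔ Stable p := by
  constructor
  · intro h w' f u
    have h := h w' f (val u)
    rw [emp_val hT] at h
    exact h
  · intro h w' f u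
    constructor
    · intro hu
      obtain ⟨u, rfl⟩ := exists_val (hP := hP) (hT (prop_val _) (map_val f _ ▸ hu))
      rw [emp_val hT]
      exact (h w' f u).1 hu
    · intro hu
      -- Here `u` is not yet known to lie in the submodel; being empty, it equals the submodel's
      -- empty set.
      obtain ⟨e, he⟩ := hN.empty w'
      obtain rfl := hK.emp_unique hu.1 ((emp_val hT).2 he)
      rw [emp_val hT] at hu
      exact (h w' f e).2 hu

theorem goodAt_val {w : K.World} {g b a : (K.sub P hP).Obj w} :
    GoodAt (val g) (val b) (val a) ↔ GoodAt g b a := by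
  have ho {w : K.World} {x y r : (K.sub P hP).Obj w} := omem_val hT hK hN (x := x) (y := y) (r := r)
  refine and_congr (func_val hT hK hN) ⟨fun h w' f x p hx => ?_, fun h w' f x p hx => ?_⟩
  · obtain ⟨⟨c, hc, hcx⟩, hp⟩ := h w' f (val x) (val p) (ho.2 hx)
    obtain ⟨c, rfl⟩ := exists_val (hP := hP) (hT (prop_val _) (map_val (K := K) f _ ▸ hc))
    exact ⟨⟨c, hc, ho.1 hcx⟩, (stable_val hT hK hN).1 hp⟩
  · rw [map_val] at hx
    obtain ⟨x, p, rfl, rfl⟩ := exists_val_of_omem hT hK hx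
    obtain ⟨⟨c, hc, hcx⟩, hp⟩ := h w' f x p (ho.1 hx)
    exact ⟨⟨val c, hc, ho.2 hcx⟩, (stable_val hT hK hN).2 hp⟩

theorem good_val {w : K.World} {g : (K.sub P hP).Obj w} : Good (val g) ↔ Good g := by
  have ho {w : K.World} {x y r : (K.sub P hP).Obj w} := omem_val hT hK hN (x := x) (y := y) (r := r)
  constructor
  · exact fun h w' f b a hba => (goodAt_val hT hK hN).1 (h w' f (val b) (val a) (ho.2 hba))
  · intro h w' f b a hba
    rw [map_val] at hba
    obtain ⟨b, a, rfl, rfl⟩ := exists_val_of_omem hT hK hba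
    exact (goodAt_val hT hK hN).2 (h w' f b a (ho.1 hba))

/-- Only upward: the witnesses move from the submodel to the model, while outer witnesses need not
lie in the submodel. -/
theorem inVOmega_val {w : K.World} {u : (K.sub P hP).Obj w} (h : InVOmega u) :
    InVOmega (val u) := by
  obtain ⟨g, b, hg, hb⟩ := h
  exact ⟨val g, val b, (good_val hT hK hN).2 hg, (omem_val hT hK hN).2 hb⟩

end

end Sub

end Model

namespace Model

variable {K : Model}

/-! ### Consequences of the axioms -/

theorem force_iff_of_isSentence {φ : Fml} (h : IsSentence φ) {w : K.World} (v v' : ℕ → K.Obj w) :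
    K.force φ v ↔ K.force φ v' :=
  K.force_congr h (by simp)

end Model

theorem isSentence_of_mem {φ : Fml} (h : φ ∈ CZFMinusNoInf) : IsSentence φ := by
  simp only [CZFMinusNoInf, Set.mem_union] at h
  rcases h with (((h | h) | h) | h) | h
  · rcases h with rfl | rfl | rfl | rfl <;>
      simp [IsSentence, FreeLt, extensionality, pairing, union, emptySet, iff, isPair, isEmpty, bex,
        neg]
  all_goals exact h.1

namespace Model

variable {K : Model} (hK : K.Satisfies CZFMinusNoInf)
include hK

/-- `Satisfies` is vacuous at a world without individuals, so Empty Set requires `hne`. -/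
theorem Satisfies.basic (hne : ∀ w, Nonempty (K.Obj w)) : Basic K where
  ext {w x y} h := by
    have := hK extensionality (by simp [CZFMinusNoInf]) w (fun _ => x)
    simp only [extensionality, force_all_all_imp] at this
    simpa [cons] using this w (K.id w) x y (by simpa [cons] using h)
  pair {w} x y := by
    have := hK pairing (by simp [CZFMinusNoInf]) w (fun _ => x)
    simp only [pairing, force_all_all] at this
    simpa [cons] using this w (K.id w) x y
  union {w} a := by
    have := hK CZF.union (by simp [CZFMinusNoInf]) w (fun _ => a) w (K.id w) a
    simpa [cons] using this
  empty w := by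
    have := hK emptySet (by simp [CZFMinusNoInf]) w fun _ => (hne w).some
    simpa [emptySet] using this

theorem Satisfies.induction (φ : Fml) {w : K.World} {v : ℕ → K.Obj w}
    (h : ∀ (w' : K.World) (f : K.Hom w w') (x : K.Obj w'),
      (∀ (w'' : K.World) (g : K.Hom w' w'') (y : K.Obj w''), K.mem y (K.map g x) →
        K.force φ (cons y fun n => K.map g (K.map f (v n)))) →
      K.force φ (cons x fun n => K.map f (v n))) (x : K.Obj w) : K.force φ (cons x v) := by
  have hS : K.Satisfies {ψ | ∃ φ, ψ = CZF.induction φ} :=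
    Satisfies.of_closures fun φ h => hK φ (.inl (.inr h))
  have := force_imp_self (hS _ ⟨φ, rfl⟩ w v) (by simpa [map_cons, cons] using h) w (K.id w) x
  simpa using this

theorem Satisfies.separation {φ : Fml} (hφ : IsDelta0 φ) {w : K.World} (v : ℕ → K.Obj w)
    (a : K.Obj w) : ∃ b, ∀ (w' : K.World) (f : K.Hom w w') (x : K.Obj w'),
      K.mem x (K.map f b) ↔ K.mem x (K.map f a) ∧ K.force φ (cons x fun n => K.map f (v n)) := by
  have hS : K.Satisfies {ψ | ∃ φ, IsDelta0 φ ∧ ψ = CZF.separation φ} :=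
    Satisfies.of_closures fun φ h => hK φ (.inl (.inl (.inl (.inr h))))
  have := hS _ ⟨φ, hφ, rfl⟩ w v w (K.id w) a
  simpa [cons] using this

theorem Satisfies.strongCollection (φ : Fml) {w : K.World} (v : ℕ → K.Obj w) {a : K.Obj w}
    (h : ∀ (w' : K.World) (f : K.Hom w w') (x : K.Obj w'), K.mem x (K.map f a) →
      ∃ y, K.force φ (cons x (cons y fun n => K.map f (v n)))) :
    ∃ b, (∀ (w' : K.World) (f : K.Hom w w') (x : K.Obj w'), K.mem x (K.map f a) →
        ∃ y, K.mem y (K.map f b) ∧ K.force φ (cons x (cons y fun n => K.map f (v n)))) ∧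
      ∀ (w' : K.World) (f : K.Hom w w') (y : K.Obj w'), K.mem y (K.map f b) →
        ∃ x, K.mem x (K.map f a) ∧ K.force φ (cons x (cons y fun n => K.map f (v n))) := by
  have hS : K.Satisfies {ψ | ∃ φ, ψ = CZF.strongCollection φ} :=
    Satisfies.of_closures fun φ h => hK φ (.inr h)
  have := force_imp_self (hS _ ⟨φ, rfl⟩ w v w (K.id w) a) (by simpa [cons] using h)
  simpa [cons] using this

/-- Every formula that is inherited from the elements of elements of elements holds of all sets. -/
theorem Satisfies.induction₃ (φ : Fml) {w : K.World} {v : ℕ → K.Obj w}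
    (h : ∀ (w' : K.World) (f : K.Hom w w') (x : K.Obj w'),
      (∀ (w'' : K.World) (g : K.Hom w' w'') (y z t : K.Obj w''), K.mem y (K.map g x) →
        K.mem z y → K.mem t z → K.force φ (cons t fun n => K.map g (K.map f (v n)))) →
      K.force φ (cons x fun n => K.map f (v n))) (x : K.Obj w) : K.force φ (cons x v) := by
  -- The induction formula is strengthened to speak of a set, its elements and their elements. Three
  -- levels are what a domain element needs: x ∈ {x, y} ∈ ⟨x, y⟩ ∈ u.
  have := hK.induction (φ ⋏ ball 0 (φ.sub1 0 2) ⋏ ball 0 (ball 0 (φ.sub1 0 3))) (v := v) ?_ x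
  · exact this.1
  intro w' f x ih
  simp only [force_conj, force_ball, force_sub1, map_cons, cons_zero, cons_succ] at ih ⊢
  have ih₀ {w'' : K.World} (g : K.Hom w' w'') {y : K.Obj w''} (hy : K.mem y (K.map g x)) :=
    (ih w'' g y hy).1
  have ih₁ {w'' : K.World} (g : K.Hom w' w'') {y z : K.Obj w''} (hy : K.mem y (K.map g x))
      (hz : K.mem z y) := by
    simpa using (ih w'' g y hy).2.1 w'' (K.id w'') z (by simpa using hz)
  have ih₂ {w'' : K.World} (g : K.Hom w' w'') {y z t : K.Obj w''} (hy : K.mem y (K.map g x))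
      (hz : K.mem z y) (ht : K.mem t z) := by
    simpa using (ih w'' g y hy).2.2 w'' (K.id w'') z (by simpa using hz) w'' (K.id w'') t
      (by simpa using ht)
  refine ⟨h w' f x fun w'' g y z t => ih₂ g, fun w'' g y => ih₀ g, fun w'' g y hy w₃ h z hz => ?_⟩
  have := ih₁ (K.comp g h) (by simpa using K.mem_map h hy) hz
  simpa using this

end Model

/-! ### Relativization -/

namespace Model

variable {K : Model}

/-- Variables below `d` take values in the submodel, while those from `d` on hold the parameters of
`A`, which may lie outside it; hence the bound on the free variables of `φ`. -/
theorem force_rel {A : Fml} {ρ : ∀ w, ℕ → K.Obj w}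
    (hρ : ∀ {v w : K.World} (f : K.Hom v w) (n : ℕ), K.map f (ρ v n) = ρ w n)
    {P : ∀ {w : K.World}, K.Obj w → Prop}
    {hP : ∀ {w w' : K.World} (f : K.Hom w w') {x : K.Obj w}, P x → P (K.map f x)}
    (hA : ∀ {w : K.World} (x : K.Obj w), K.force A (cons x (ρ w)) ↔ P x)
    {φ : Fml} {d : ℕ} (hφ : FreeLt d φ) {w : K.World} {v : ℕ → K.Obj w}
    {v' : ℕ → (K.sub P hP).Obj w} (hv : ∀ i < d, v i = val (v' i)) (hd : ∀ k, v (k + d) = ρ w k) :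
    K.force (rel A d φ) v ↔ (K.sub P hP).force φ v' := by
  have hcons {d : ℕ} {w : K.World} {v : ℕ → K.Obj w} {v' : ℕ → (K.sub P hP).Obj w}
      (hv : ∀ i < d, v i = val (v' i)) (x : (K.sub P hP).Obj w) :
      ∀ i < d + 1, cons (val x) v i = val (cons x v' i) := by
    rintro (_ | i) hi
    · rfl
    · exact hv i (by omega)
  have hmap {d : ℕ} {w w' : K.World} {v : ℕ → K.Obj w} {v' : ℕ → (K.sub P hP).Obj w}
      (hv : ∀ i < d, v i = val (v' i)) (f : K.Hom w w') :
      ∀ i < d, K.map f (v i) = val ((K.sub P hP).map f (v' i)) := fun i hi => by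
    rw [hv i hi, map_val]
  have hmap' {d : ℕ} {w w' : K.World} {v : ℕ → K.Obj w} (hd : ∀ k, v (k + d) = ρ w k)
      (f : K.Hom w w') (k : ℕ) : K.map f (v (k + d)) = ρ w' k := by rw [hd, hρ]
  have hsub {d : ℕ} {w : K.World} {v : ℕ → K.Obj w} (hd : ∀ k, v (k + d) = ρ w k) (x : K.Obj w) :
      K.force (A.sub1 0 (d + 1)) (cons x v) ↔ P x := by
    simp only [force_sub1, cons_zero, ← add_assoc, cons_succ, hd, hA]
  induction φ generalizing d w with
  | bot => exact Iff.rfl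
  | mem x y => simp only [rel, force_mem, hv _ hφ.1, hv _ hφ.2, mem_val]
  | eq x y => simp only [rel, force_eq, hv _ hφ.1, hv _ hφ.2, val_inj]
  | conj _ _ h₁ h₂ => exact and_congr (h₁ hφ.1 hv hd) (h₂ hφ.2 hv hd)
  | disj _ _ h₁ h₂ => exact or_congr (h₁ hφ.1 hv hd) (h₂ hφ.2 hv hd)
  | imp _ _ h₁ h₂ =>
    exact forall_congr' fun w' => forall_congr' fun f =>
      imp_congr (h₁ hφ.1 (hmap hv f) (hmap' hd f)) (h₂ hφ.2 (hmap hv f) (hmap' hd f))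
  | all φ ih =>
    simp only [rel, force_all_imp]
    have key (w' : K.World) (f : K.Hom w w') (x : (K.sub P hP).Obj w') :=
      ih (d := d + 1) hφ (hcons (hmap hv f) x) (by simpa [← add_assoc] using hmap' hd f)
    refine ⟨fun h w' f x => (key w' f x).1 (h w' f (val x) ((hsub (hmap' hd f) _).2 x.2)),
      fun h w' f x hx => ?_⟩
    exact (key w' f ⟨x, (hsub (hmap' hd f) _).1 hx⟩).2 (h w' f _)
  | ex φ ih =>
    simp only [rel, force_ex, force_conj]
    have key (x : (K.sub P hP).Obj w) :=
      ih (d := d + 1) hφ (hcons hv x) (by simpa [← add_assoc] using hd)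
    constructor
    · rintro ⟨x, hx, h⟩
      exact ⟨⟨x, (hsub hd _).1 hx⟩, (key _).1 h⟩
    · rintro ⟨x, h⟩
      exact ⟨val x, (hsub hd _).2 x.2, (key x).2 h⟩

/-- Relativization depends only on the extension of the class, so `A` may be replaced by "element of
`a`" when `a` is the set of its members. -/
theorem force_rel_congr {A B : Fml} {φ : Fml} {d : ℕ} (hφ : FreeLt d φ) {w : K.World}
    {v v' : ℕ → K.Obj w} (hv : ∀ i < d, v i = v' i)
    (hd : ∀ (w' : K.World) (f : K.Hom w w') (x : K.Obj w'),
      K.force A (cons x fun k => K.map f (v (k + d))) ↔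
        K.force B (cons x fun k => K.map f (v' (k + d)))) :
    K.force (rel A d φ) v ↔ K.force (rel B d φ) v' := by
  have hcons {d : ℕ} {w : K.World} {v v' : ℕ → K.Obj w} (hv : ∀ i < d, v i = v' i) (x : K.Obj w) :
      ∀ i < d + 1, cons x v i = cons x v' i := by
    rintro (_ | i) hi
    · rfl
    · exact hv i (by omega)
  have hmap {d : ℕ} {w w' : K.World} {v v' : ℕ → K.Obj w} (hv : ∀ i < d, v i = v' i)
      (f : K.Hom w w') : ∀ i < d, K.map f (v i) = K.map f (v' i) := fun i hi => by rw [hv i hi]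
  induction φ generalizing d w with
  | bot => exact Iff.rfl
  | mem x y => simp only [rel, force_mem, hv _ hφ.1, hv _ hφ.2]
  | eq x y => simp only [rel, force_eq, hv _ hφ.1, hv _ hφ.2]
  | conj _ _ h₁ h₂ => exact and_congr (h₁ hφ.1 hv hd) (h₂ hφ.2 hv hd)
  | disj _ _ h₁ h₂ => exact or_congr (h₁ hφ.1 hv hd) (h₂ hφ.2 hv hd)
  | imp _ _ h₁ h₂ =>
    refine forall_congr' fun w' => forall_congr' fun f =>
      imp_congr (h₁ hφ.1 (hmap hv f) ?_) (h₂ hφ.2 (hmap hv f) ?_) <;>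
    exact fun w'' g x => by simpa using hd w'' (K.comp f g) x
  | all φ ih =>
    simp only [rel, force_all_imp, force_sub1, cons_zero, ← add_assoc, cons_succ]
    refine forall_congr' fun w' => forall_congr' fun f => forall_congr' fun x =>
      imp_congr (hd w' f x) (ih (d := d + 1) hφ (hcons (hmap hv f) x) fun w'' g y => ?_)
    simpa [← add_assoc] using hd w'' (K.comp f g) y
  | ex φ ih =>
    simp only [rel, force_ex, force_conj, force_sub1, cons_zero, ← add_assoc, cons_succ]
    refine exists_congr fun x => and_congr (by simpa using hd w (K.id w) x)
      (ih (d := d + 1) hφ (hcons hv x) fun w'' g y => ?_)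
    simpa [← add_assoc] using hd w'' g y

end Model

/-- The class `mem 0 1` consists of the elements of its parameter 0, which under `d` binders is
variable `d`; its relativized quantifiers are literally `ball d` and `bex d`. -/
theorem isDelta0_rel_mem (φ : Fml) (d : ℕ) : IsDelta0 (rel (mem 0 1) d φ) := by
  induction φ generalizing d with
  | bot => exact .bot
  | mem x y => exact .mem x y
  | eq x y => exact .eq x y
  | conj _ _ h₁ h₂ => exact .conj (h₁ d) (h₂ d)
  | disj _ _ h₁ h₂ => exact .disj (h₁ d) (h₂ d)
  | imp _ _ h₁ h₂ => exact .imp (h₁ d) (h₂ d)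
  | all _ ih =>
    simp only [rel, sub1, Fml.rename, zero_add]
    exact .ball d (ih (d + 1))
  | ex _ ih =>
    simp only [rel, sub1, Fml.rename, zero_add]
    exact .bex d (ih (d + 1))

theorem freeLt_VOmega : FreeLt 1 VOmega := by
  simp [VOmega, FreeLt, isGood, isFunction, isStable, isOPair, isPair, isEmpty, opairMem, iff,
    neg, bex, ball]

/-! ### Absoluteness of `V^Ω` -/

namespace Model

/-- The submodel given by a transitive class that is a model of `CZF⁻` without Infinity computes
`V^Ω` correctly. -/
theorem force_relOmega {K : Model} {A : Fml} {ρ : ∀ w, ℕ → K.Obj w}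
    (hρ : ∀ {v w : K.World} (f : K.Hom v w) (n : ℕ), K.map f (ρ v n) = ρ w n)
    (h : ∀ φ ∈ transitiveModel A, ∀ w, K.force φ (ρ w)) {w : K.World} (u : K.Obj w) :
    K.force (relOmega A) (cons u (ρ w)) ↔ InVOmega u ∧ K.force A (cons u (ρ w)) := by
  let P : ∀ {w : K.World}, K.Obj w → Prop := fun {w} x => K.force A (cons x (ρ w))
  have hP {w w' : K.World} (f : K.Hom w w') {x : K.Obj w} (hx : P x) : P (K.map f x) := by
    simpa [map_cons, hρ] using K.force_map hx f
  have hT {w : K.World} {x y : K.Obj w} (hx : P x) (hy : K.mem y x) : P y := by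
    have := h (transitive A) (.inl (.inr rfl)) w
    simp only [transitive, force_all_imp, force_ball, force_sub1] at this
    simpa [hρ] using this w (K.id w) x (by simpa [hρ] using hx) w (K.id w) y (by simpa using hy)
  have hrel {φ : Fml} (hφ : φ ∈ CZFMinusNoInf) (w : K.World) : K.force (rel A 0 φ) (ρ w) :=
    h _ (.inr ⟨φ, hφ, rfl⟩) w
  have hKS : K.Satisfies CZFMinusNoInf := fun φ hφ w v =>
    (force_iff_of_isSentence (isSentence_of_mem hφ) v (ρ w)).2 (h φ (.inl (.inl (.inr hφ))) w)
  have hNS : (K.sub P hP).Satisfies CZFMinusNoInf := fun φ hφ w v =>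
    (force_rel (hP := hP) hρ (fun _ => Iff.rfl) (isSentence_of_mem hφ) (by simp)
      fun k => rfl).1 (hrel hφ w)
  have hK := hKS.basic fun w => ⟨ρ w 0⟩
  have hN := hNS.basic fun w => by
    have := hrel (φ := emptySet) (by simp [CZFMinusNoInf]) w
    simp only [emptySet, rel, force_ex, force_conj, force_sub1] at this
    obtain ⟨e, he, -⟩ := this
    exact ⟨⟨e, he⟩⟩
  have hiff {w : K.World} (x : (K.sub P hP).Obj w) :
      K.force (rel A 1 VOmega) (cons (val x) (ρ w)) ↔ InVOmega x := by
    rw [← force_VOmega (v := fun _ => x)]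
    refine force_rel (hP := hP) hρ (fun _ => Iff.rfl) freeLt_VOmega (fun i hi => ?_) fun k => rfl
    obtain rfl : i = 0 := by omega
    rfl
  -- The inclusion V^Ω ∩ A ⊆ A^Ω, written as a formula so that ∈-induction of the universe applies
  -- to it.
  have key : K.force (A ⟹ VOmega ⟹ rel A 1 VOmega) (cons u (ρ w)) := by
    refine hKS.induction₃ _ (fun w f u ih => ?_) u
    simp only [force_imp, force_VOmega, map_cons, cons_zero, hρ, ← map_comp] at ih ⊢
    intro w₁ f₁ hu w₂ f₂ hV
    generalize hu' : K.map (K.comp f₁ f₂) u = u' at hV ⊢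
    have hPu : P u' := by
      rw [← hu', map_comp]
      exact hP f₂ hu
    obtain ⟨u', rfl⟩ := exists_val (hP := hP) hPu
    rw [hiff]
    obtain ⟨g, b, hg, hb⟩ := hV
    obtain ⟨hfun, hdom⟩ := hg.goodAt hb
    have hfun' := (func_val hT hK hN).1 hfun
    have hcov {w : K.World} (f : K.Hom w₂ w) {p x y : (K.sub P hP).Obj w}
        (hp : (K.sub P hP).mem p ((K.sub P hP).map f u')) (hpx : OPair p x y) : InVOmega x := by
      have hpx' := (opair_val hT hK hN).2 hpx
      obtain ⟨⟨c, -, hc⟩, -⟩ := hdom w f (val x) (val y) ⟨val p, hp, hpx'⟩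
      obtain ⟨t, htp, hxt, -⟩ := hK.exists_mem_left_right hpx'
      have hpu : K.mem (val p) (K.map (K.comp (K.comp f₁ f₂) f) u) := by
        rw [map_comp, hu']
        exact hp
      -- The good set for `u` also witnesses x ∈ V^Ω, at the earlier stage `c`.
      have := ih _ _ (val p) t (val x) hpu htp hxt w (K.id w) (by simpa using prop_val x) w
        (K.id w) ⟨K.map f g, c, hg.map f, by simpa using hc⟩
      rw [← hiff]
      simpa using this
    -- Collection runs over the pairs p ∈ u inside the submodel. In the formula, 3 is p = ⟨x, y⟩, 4
    -- is the collected good set, and 2, 1, 0 are the stage, x and y. The second half of Strong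
    -- Collection ensures that every member of `B` is good.
    obtain ⟨B, hB, hB'⟩ := hNS.strongCollection
      (ex (ex (ex (isOPair 3 1 0 ⋏ isGood 4 ⋏ opairMem 2 1 4)))) (fun _ => u') (a := u') (by
        intro w f p hp
        obtain ⟨x, y, hxy⟩ := hfun'.1 w f p hp
        obtain ⟨g, b, hg, hb⟩ := hcov f hp hxy
        exact ⟨g, b, x, y, by simpa [cons] using ⟨hxy, hg, hb⟩⟩)
    simp only [force_ex, force_conj, force_isOPair, force_isGood, force_opairMem] at hB hB'
    refine hN.inVOmega_of_cover (B := B) hfun' (fun w f x p hx => ?_) (fun w f g hg => ?_)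
      fun w f x p hx => ?_
    · refine (stable_val hT hK hN).1 (hdom w f (val x) (val p) ?_).2
      exact (omem_val hT hK hN).2 hx
    · obtain ⟨p, -, b, x, y, -, hg, -⟩ := hB' w f g hg
      exact hg
    · obtain ⟨q, hq, hqx⟩ := hx
      obtain ⟨g, hg, b, x', y, hqx', -, hb⟩ := hB w f q hq
      obtain ⟨rfl, rfl⟩ := hN.opair_inj hqx hqx'
      exact ⟨g, hg, b, hb⟩
  constructor
  · rintro ⟨hA, hu⟩
    obtain ⟨u, rfl⟩ := exists_val (hP := hP) hA
    exact ⟨inVOmega_val hT hK hN ((hiff u).1 hu), hA⟩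
  · rintro ⟨hu, hA⟩
    exact ⟨hA, force_imp_self (force_imp_self key hA) (by simpa using hu)⟩

end Model

end CZF

open CZF CZF.Model in
/-- For every class `A` (with parameters), `CZF⁻` proves intuitionistically: if `A` is a transitive
model of `CZF⁻` without Infinity, then `A^Ω = V^Ω ∩ A`, and if `A` is a set, so is `A^Ω`. -/
theorem lemma4p3 (A : CZF.Fml) :
    CZF.Prf (CZF.transitiveModel A)
      (CZF.classEq (CZF.relOmega A) (CZF.VOmega ⋏ A)) ∧
    CZF.Prf (insert (CZF.isSet A) (CZF.transitiveModel A))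
      (CZF.isSet (CZF.relOmega A)) := by
  constructor
  · refine Prf.of_force fun K ρ hρ h w => ?_
    rw [classEq, force_all_iff]
    intro w' f u
    simpa [hρ] using force_relOmega hρ h u
  · refine Prf.of_force fun K ρ hρ h w => ?_
    have hS : K.Satisfies CZFMinusNoInf := fun φ hφ w v =>
      (force_iff_of_isSentence (isSentence_of_mem hφ) v (ρ w)).2
        (h φ (.inr (.inl (.inl (.inr hφ)))) w)
    obtain ⟨a, ha⟩ := h (isSet A) (.inl rfl) w
    simp only [force_all_iff, force_mem, force_sub1, map_cons, cons_zero, cons_succ, hρ] at ha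
    -- The constant valuation places `a` at variable 1, the class parameter; variable 0 is the
    -- element being separated.
    obtain ⟨b, hb⟩ := hS.separation (isDelta0_rel_mem VOmega 1) (fun _ => a) a
    refine ⟨b, ?_⟩
    simp only [force_all_iff, force_mem, force_sub1, map_cons, cons_zero, cons_succ, hρ]
    intro w' f u
    have ha' : K.mem u (K.map f a) ↔ K.force A (cons u (ρ w')) := by
      simpa [cons, hρ] using ha w' f u
    have hrel : K.force (rel (Fml.mem 0 1) 1 VOmega) (cons u fun _ => K.map f a) ↔
        K.force (rel A 1 VOmega) (cons u (ρ w')) := by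
      refine force_rel_congr freeLt_VOmega (fun i hi => ?_) fun w'' g x => ?_
      · obtain rfl : i = 0 := by omega
        rfl
      · simpa [cons, hρ] using ha w'' (K.comp f g) x
    simpa [cons, hρ, relOmega, relClass] using (hb w' f u).trans (and_congr ha' hrel)
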